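/- Let $p\ge 1$ and $q$ be integers, $A_1,\dots,A_p>0$, $B_1,\dots,B_q>0$, and let $a_1,\dots,a_p$, $b_1,\dots,b_q$ be real. Put $$\rho=\prod_{k=1}^pA_k^{A_k}\prod_{j=1}^qB_j^{-B_j},\qquad \mu=\sum_{j=1}^q b_j-\sum_{k=1}^p a_k+\frac{p-q}{2},\qquad \gamma=-\min_{1\le k\le p}\frac{a_k}{A_k},$$ $$\nu=(2\pi)^{(p-q)/2}\prod_{k=1}^pA_k^{a_k-1/2}\prod_{j=1}^qB_j^{1/2-b_j}.$$ Let $\mathcal B_n$ be the $n$-th Bernoulli polynomial, given by $te^{at}/(e^t-1)=\sum_{n\ge0}\mathcal B_n(a)t^n/n!$, and define $l_0=1$ and, for $r\ge1$, $$l_r=\frac1r\sum_{n=1}^r q_n\,l_{r-n},\qquad q_n=\frac{(-1)^{n+1}}{n+1}\left[\sum_{k=1}^p\frac{\mathcal B_{n+1}(a_k)}{A_k^n}-\sum_{j=1}^q\frac{\mathcal B_{n+1}(b_j)}{B_j^n}\right].$$ For $x>0$, $x\ne\rho$, let Fox's function be $$H(x)=H^{p,0}_{q,p}\left(x\,\middle|\,{(\mathbf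 B,\mathbf b)\atop(\mathbf A,\mathbf a)}\right)=\frac1{2\pi i}\int_{\mathcal L}\frac{\prod_{k=1}^p\Gamma(A_kz+a_k)}{\prod_{j=1}^q\Gamma(B_jz+b_j)}\,x^{-z}\,dz .$$ Here $c>\gamma$ and $\varphi_1<0<\varphi_2$ are any fixed real numbers; for $x<\rho$ the contour $\mathcal L$ is the left loop that runs horizontally from $-\infty+i\varphi_1$ to $c+i\varphi_1$, vertically to $c+i\varphi_2$ and horizontally to $-\infty+i\varphi_2$, and for $x>\rho$ it is the right loop that runs horizontally from $+\infty+i\varphi_1$ to $c+i\varphi_1$, vertically to $c+i\varphi_2$ and horizontally to $+\infty+i\varphi_2$. (All poles of the integrand lie to the left of these loops.) **Theorem 2.** Suppose that $\sum_{j=1}^qB_j=\sum_{k=1}^pA_k$ and that $\mu=-m$ with $m\in\{0,1,2,\dots\}$. Then for every complex $s$ with $\Re s>\gamma$ the Mellin transform of $H$ exists, that is, $H(x)x^{s-1}$ is (absolutely) integrable on $(0,\infty)$, and $$\int_0^\infty H(x)x^{s-1}\,dx=\int_0^\rho H(x)x^{s-1}\,dx=\frac{\prod_{k=1}^p\Gamma(A_ks+a_k)}{\prod_{j=1}^q\Gamma(B_js+b_j)}-\nu\rho^s\sum_{k=0}^m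 l_{m-k}s^k .$$ -/

import Mathlib

/-!
Fox's function `H^{p,0}_{q,p}(x | (B,b); (A,a))` for positive `A`, `B` and real `a`, `b`,
with `∑ B = ∑ A`, and the constants attached to it.
-/

noncomputable section

namespace FoxH

variable {p q : ℕ}

/-- The gamma ratio `∏ₖ Γ(Aₖ s + aₖ) / ∏ⱼ Γ(Bⱼ s + bⱼ)`. Mathlib's `Γ` is `0` at its poles, so
the factor `1 / Γ(Bⱼ s + bⱼ)` is `0` there, as it should be. -/
def gammaRatio (A a : Fin p → ℝ) (B b : Fin q → ℝ) (s : ℂ) : ℂ :=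
  (∏ k, Complex.Gamma ((A k : ℂ) * s + (a k : ℂ))) /
    ∏ j, Complex.Gamma ((B j : ℂ) * s + (b j : ℂ))

/-- `Δ = ∑ⱼ Bⱼ - ∑ₖ Aₖ`. -/
def Delta (A : Fin p → ℝ) (B : Fin q → ℝ) : ℝ := ∑ j, B j - ∑ k, A k

/-- `μ = ∑ⱼ bⱼ - ∑ₖ aₖ + (p - q) / 2`. -/
def mu (a : Fin p → ℝ) (b : Fin q → ℝ) : ℝ :=
  ∑ j, b j - ∑ k, a k + ((p : ℝ) - (q : ℝ)) / 2

/-- `ρ = ∏ₖ Aₖ ^ Aₖ * ∏ⱼ Bⱼ ^ (-Bⱼ)`. -/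
def rho (A : Fin p → ℝ) (B : Fin q → ℝ) : ℝ :=
  (∏ k, A k ^ A k) * ∏ j, B j ^ (-B j)

/-- `ν = (2π) ^ ((p - q) / 2) * ∏ₖ Aₖ ^ (aₖ - 1/2) * ∏ⱼ Bⱼ ^ (1/2 - bⱼ)`. -/
def nu (A a : Fin p → ℝ) (B b : Fin q → ℝ) : ℝ :=
  (2 * Real.pi) ^ (((p : ℝ) - (q : ℝ)) / 2) *
    (∏ k, A k ^ (a k - 1 / 2)) * ∏ j, B j ^ (1 / 2 - b j)

/-- `γ = - minₖ (aₖ / Aₖ)`; for `p ≥ 1` the infimum of this finite family is its minimum. -/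
def gam (A a : Fin p → ℝ) : ℝ := -⨅ k, a k / A k

/-- The value at `x` of the `n`-th Bernoulli polynomial. -/
def bernoulliPoly (n : ℕ) (x : ℝ) : ℝ := Polynomial.aeval x (Polynomial.bernoulli n)

/-- `qₘ = (-1)^(m+1) / (m+1) * (∑ₖ ℬ_{m+1}(aₖ) / Aₖ^m - ∑ⱼ ℬ_{m+1}(bⱼ) / Bⱼ^m)`. -/
def qCoeff (A a : Fin p → ℝ) (B b : Fin q → ℝ) (m : ℕ) : ℝ :=
  (-1) ^ (m + 1) / ((m : ℝ) + 1) *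
    (∑ k, bernoulliPoly (m + 1) (a k) / A k ^ m - ∑ j, bernoulliPoly (m + 1) (b j) / B j ^ m)

/-- `l₀ = 1` and `l_r = (1/r) ∑_{m=1}^r qₘ l_{r-m}` for `r ≥ 1` (below, `m = i + 1` and the index
`r` of this formula is `r + 1`). -/
def lCoeff (A a : Fin p → ℝ) (B b : Fin q → ℝ) : ℕ → ℝ
  | 0 => 1
  | r + 1 => 1 / ((r : ℝ) + 1) *
      ∑ i : Fin (r + 1), qCoeff A a B b (i + 1) * lCoeff A a B b (r - i)
decreasing_by omega

/-- The integral of `F` over the left loop that runs from `-∞ + iφ₁` along a horizontal ray to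
`c + iφ₁`, then along a vertical segment to `c + iφ₂`, then along a horizontal ray to
`-∞ + iφ₂`. -/
def leftLoopIntegral (c φ₁ φ₂ : ℝ) (F : ℂ → ℂ) : ℂ :=
  (∫ t in Set.Iic c, F (t + φ₁ * Complex.I)) +
    Complex.I * (∫ t in φ₁..φ₂, F (c + t * Complex.I)) -
    ∫ t in Set.Iic c, F (t + φ₂ * Complex.I)

/-- The integral of `F` over the right loop that runs from `+∞ + iφ₁` along a horizontal ray to
`c + iφ₁`, then along a vertical segment to `c + iφ₂`, then along a horizontal ray to
`+∞ + iφ₂`. -/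
def rightLoopIntegral (c φ₁ φ₂ : ℝ) (F : ℂ → ℂ) : ℂ :=
  -(∫ t in Set.Ici c, F (t + φ₁ * Complex.I)) +
    Complex.I * (∫ t in φ₁..φ₂, F (c + t * Complex.I)) +
    ∫ t in Set.Ici c, F (t + φ₂ * Complex.I)

/-- Fox's function at `x > 0`: the Mellin-Barnes integral
`(1 / 2πi) ∫ ∏ₖ Γ(Aₖ s + aₖ) / ∏ⱼ Γ(Bⱼ s + bⱼ) x^{-s} ds` in the case `Δ = 0`, over a left loop
for `x < ρ` and over a right loop for `x > ρ`. All poles of the integrand are real and at most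
`γ`, so they lie to the left of both loops if `γ < c` and `φ₁ < 0 < φ₂`. The value at the single
point `x = ρ` plays no role. -/
def H (A a : Fin p → ℝ) (B b : Fin q → ℝ) (c φ₁ φ₂ : ℝ) (x : ℝ) : ℂ :=
  1 / (2 * Real.pi * Complex.I) *
    if x < rho A B then
      leftLoopIntegral c φ₁ φ₂ fun s => gammaRatio A a B b s * (x : ℂ) ^ (-s)
    else
      rightLoopIntegral c φ₁ φ₂ fun s => gammaRatio A a B b s * (x : ℂ) ^ (-s)

end FoxH

end

/-!
Stirling's series for `Γ(z + a)`, with Bernoulli polynomial coefficients, holds in the sector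
`|arg z| ≤ 3π/4`: by the recursion for Bernoulli polynomials, its truncation satisfies the equation
`log Γ(z + 1 + a) = log Γ(z + a) + log (z + a)` up to `O(z^{-N-2})`, so telescoping leaves a
constant plus `O(z^{-N-1})`, and Stirling's formula for `n!` fixes the constant. When `Δ = 0` and
`μ = -m`, the logarithms cancel in the gamma ratio `G`, so that `G(z) ρ^{-z} = P(z) + O(1/z)` in
that sector, where `P(z) = ν ∑ l_{m-k} z^k`. By the reflection formula, `G(z) ρ^{-z}` is also
`O(z^m)` in every left half plane, at any positive distance from the real axis.

For `x > ρ` the right loop can be pushed to infinity, so `H(x) = 0`. For `x < ρ` the left loop can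
be opened to an angle with vertex between `γ` and `Re s` and with sides inside the sector, in the
directions `-1 ± 2i`; the polynomial `P` contributes nothing there, which leaves
`R(z) = G(z) ρ^{-z} - P(z) = O(1/z)`. Fubini's theorem and `∫₀^ρ (ρ/x)^z x^{s-1} dx = ρ^s / (s - z)`
turn the Mellin transform into a Cauchy integral of `R` over the angle, whose value is `ρ^s R(s)`.
-/

noncomputable section

namespace FoxH

open Asymptotics Bornology Complex Filter MeasureTheory Set Topology

/-! ### The coefficients of the Stirling series -/

/-- The coefficient of `z ^ (-(i + 1))` in the Stirling series of `log Γ(z + a)`. -/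
def stirlingCoeff (a : ℝ) (i : ℕ) : ℝ :=
  (-1) ^ i * bernoulliPoly (i + 2) a / (((i : ℝ) + 1) * ((i : ℝ) + 2))

lemma bernoulliPoly_zero (a : ℝ) : bernoulliPoly 0 a = 1 := by simp [bernoulliPoly]

lemma bernoulliPoly_one (a : ℝ) : bernoulliPoly 1 a = a - 1 / 2 := by simp [bernoulliPoly]

lemma sum_choose_mul_bernoulliPoly (a : ℝ) (n : ℕ) :
    ∑ k ∈ Finset.range (n + 1), ((n + 1).choose k : ℝ) * bernoulliPoly k a = (n + 1) * a ^ n := by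
  simpa [bernoulliPoly, Algebra.smul_def, Polynomial.aeval_monomial, add_mul] using
    congrArg (Polynomial.aeval a) (Polynomial.sum_bernoulli n)

lemma sum_choose_add_two_mul_bernoulliPoly (a : ℝ) (k : ℕ) :
    ∑ i ∈ Finset.range k, ((k + 2).choose (i + 2) : ℝ) * bernoulliPoly (i + 2) a =
      (k + 2) * a ^ (k + 1) - 1 - (k + 2) * (a - 1 / 2) := by
  have h := sum_choose_mul_bernoulliPoly a (k + 1)
  rw [Finset.sum_range_succ', Finset.sum_range_succ', bernoulliPoly_zero, bernoulliPoly_one] at h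
  simp only [Nat.choose_zero_right, zero_add, Nat.choose_one_right] at h
  push_cast at h
  linear_combination h

lemma choose_add_two_mul (k i : ℕ) :
    (k + 2).choose (i + 2) * ((i + 1) * (i + 2)) = (k + 1) * (k + 2) * k.choose i := by
  calc (k + 2).choose (i + 2) * ((i + 1) * (i + 2))
    _ = (k + 1 + 1).choose (i + 1 + 1) * (i + 1 + 1) * (i + 1) := by ring
    _ = (k + 2) * ((k + 1).choose (i + 1) * (i + 1)) := by rw [← Nat.add_one_mul_choose_eq]; ring
    _ = (k + 1) * (k + 2) * k.choose i := by rw [← Nat.add_one_mul_choose_eq]; ring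

lemma stirlingCoeff_mul_choose (a : ℝ) (k i : ℕ) :
    stirlingCoeff a i * ((-1) ^ (k + i) * (k.choose i : ℝ)) =
      (-1) ^ k / (((k : ℝ) + 1) * (k + 2)) *
        (((k + 2).choose (i + 2) : ℝ) * bernoulliPoly (i + 2) a) := by
  have hsign : ((-1 : ℝ) ^ i) * (-1) ^ (k + i) = (-1) ^ k := by
    rw [← pow_add, show i + (k + i) = k + 2 * i by ring, pow_add, pow_mul]
    simp
  have hchoose : ((k + 2).choose (i + 2) : ℝ) * ((i + 1) * (i + 2)) =
      (k + 1) * (k + 2) * k.choose i := mod_cast choose_add_two_mul k i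
  rw [stirlingCoeff, div_mul_eq_mul_div, div_mul_eq_mul_div,
    div_eq_div_iff (by positivity) (by positivity)]
  linear_combination (bernoulliPoly (i + 2) a * (k.choose i) * (k + 1) * (k + 2)) * hsign
    - ((-1) ^ k * bernoulliPoly (i + 2) a) * hchoose

lemma sum_stirlingCoeff_mul_choose (a : ℝ) (k : ℕ) :
    ∑ i ∈ Finset.range k, stirlingCoeff a i * ((-1) ^ (k + i) * (k.choose i : ℝ)) =
      (-1) ^ k * a ^ (k + 1) / (k + 1) - (-1) ^ (k + 1) / (k + 2) -
        (a + 1 / 2) * ((-1) ^ k / (k + 1)) := by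
  simp_rw [stirlingCoeff_mul_choose, ← Finset.mul_sum, sum_choose_add_two_mul_bernoulliPoly,
    pow_succ (-1 : ℝ) k]
  field_simp
  ring

/-! ### The defect of the truncated Stirling series in the functional equation of `Γ` -/

lemma hasSum_log_one_add_mul {a w : ℂ} (h : ‖a * w‖ < 1) :
    HasSum (fun k : ℕ => ((-1) ^ k * a ^ (k + 1) / (k + 1)) * w ^ (k + 1))
      (log (1 + a * w)) := by
  have h' := (hasSum_nat_add_iff' 1).2 (hasSum_taylorSeries_log h)
  simp only [Finset.range_one, Finset.sum_singleton, Nat.cast_zero, div_zero, sub_zero] at h'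
  convert! h' using 2 with k
  push_cast
  ring

lemma hasSum_inv_mul_log_one_add {w : ℂ} (hw : w ≠ 0) (h : ‖w‖ < 1) :
    HasSum (fun k : ℕ => ((-1) ^ (k + 1) / ((k : ℂ) + 2)) * w ^ (k + 1))
      (w⁻¹ * log (1 + w) - 1) := by
  have h' := (hasSum_nat_add_iff' 1).2
    ((hasSum_log_one_add_mul (a := 1) (w := w) (by simpa using h)).mul_left w⁻¹)
  simp only [Finset.range_one, Finset.sum_singleton] at h'
  convert! h' using 2 with k
  · push_cast
    rw [pow_succ w (k + 1), show (k : ℂ) + 1 + 1 = k + 2 by ring]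
    field_simp
    simp
  · simp
  · simp [hw]

lemma hasSum_div_one_add_pow {w : ℂ} (h : ‖w‖ < 1) (i : ℕ) :
    HasSum (fun k : ℕ => ((-1) ^ (k + i) * (k.choose i : ℂ)) * w ^ (k + 1))
      ((w / (1 + w)) ^ (i + 1)) := by
  have h' := (hasSum_choose_mul_geometric_of_norm_lt_one (𝕜 := ℂ) i (r := -w)
    (by simpa using h)).mul_left (w ^ (i + 1))
  rw [sub_neg_eq_add, mul_one_div, ← div_pow] at h'
  refine (hasSum_nat_add_iff' i).1 ?_
  rw [Finset.sum_eq_zero fun k hk => by rw [Nat.choose_eq_zero_of_lt (Finset.mem_range.1 hk)]; simp,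
    sub_zero]
  convert! h' using 2 with k
  rw [neg_pow w k, show k + i + i = k + 2 * i by ring, pow_add (-1 : ℂ), pow_mul]
  simp only [even_two, Even.neg_pow, one_pow, mul_one]
  ring

/-- The logarithm of `(z + a) f(z) / f(z + 1)`, as a function of `w = 1 / z`, where `f` is the
exponential of the Stirling series of `log Γ(z + a)` truncated after `N` terms. -/
def stirlingDefect (a : ℝ) (N : ℕ) (w : ℂ) : ℂ :=
  log (1 + a * w) - (w⁻¹ + a + 1 / 2) * log (1 + w) + 1 -
    ∑ i ∈ Finset.range N, (stirlingCoeff a i : ℂ) * ((w / (1 + w)) ^ (i + 1) - w ^ (i + 1))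

/-- The coefficient of `w ^ (k + 1)` in the power series of `stirlingDefect a N w`. -/
def stirlingDefectCoeff (a : ℝ) (N k : ℕ) : ℝ :=
  (-1) ^ k * a ^ (k + 1) / (k + 1) - (-1) ^ (k + 1) / (k + 2) -
    (a + 1 / 2) * ((-1) ^ k / (k + 1)) -
    ∑ i ∈ Finset.range N, stirlingCoeff a i *
      ((-1) ^ (k + i) * (k.choose i : ℝ) - if k = i then 1 else 0)

lemma hasSum_stirlingDefect (a : ℝ) (N : ℕ) {w : ℂ} (hw : w ≠ 0) (h : ‖w‖ < 1)
    (ha : ‖a * w‖ < 1) :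
    HasSum (fun k : ℕ => (stirlingDefectCoeff a N k : ℂ) * w ^ (k + 1))
      (stirlingDefect a N w) := by
  have hlog := (hasSum_log_one_add_mul (a := 1) (w := w) (by simpa using h)).mul_left
    ((a : ℂ) + 1 / 2)
  have hterm : ∀ i ∈ Finset.range N, HasSum (fun k : ℕ => (stirlingCoeff a i : ℂ) *
      (((-1) ^ (k + i) * (k.choose i : ℂ)) * w ^ (k + 1) - if k = i then w ^ (i + 1) else 0))
      ((stirlingCoeff a i : ℂ) * ((w / (1 + w)) ^ (i + 1) - w ^ (i + 1))) := fun i _ =>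
    ((hasSum_div_one_add_pow h i).sub (hasSum_ite_eq i _)).mul_left _
  convert! (((hasSum_log_one_add_mul ha).sub (hasSum_inv_mul_log_one_add hw h)).sub hlog).sub
    (hasSum_sum hterm) using 1
  · ext k
    unfold stirlingDefectCoeff
    push_cast
    rw [sub_mul, sub_mul, sub_mul, Finset.sum_mul]
    congr 1
    · simp only [one_pow, mul_one]
      ring
    · refine Finset.sum_congr rfl fun i _ => ?_
      split_ifs with hki
      · subst hki; simp only [ofReal_one]; ring
      · simp only [ofReal_zero]; ring
  · rw [stirlingDefect, one_mul]; ring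

lemma stirlingDefectCoeff_eq_zero (a : ℝ) {N k : ℕ} (hk : k ≤ N) :
    stirlingDefectCoeff a N k = 0 := by
  rw [stirlingDefectCoeff, ← sum_stirlingCoeff_mul_choose, sub_eq_zero,
    ← Finset.sum_subset (Finset.range_subset_range.2 hk)]
  · refine Finset.sum_congr rfl fun i hi => ?_
    rw [if_neg (Finset.mem_range.1 hi).ne', sub_zero]
  · intro i _ hi
    rw [Finset.mem_range, not_lt] at hi
    rcases hi.eq_or_lt with rfl | h
    · rw [← two_mul, pow_mul]
      simp
    · simp [Nat.choose_eq_zero_of_lt h, h.ne]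

lemma isBigO_pow_of_hasSum {d : ℕ → ℂ} {f : ℂ → ℂ} {m : ℕ} (hd : ∀ k < m, d k = 0)
    (hf : ∀ᶠ w in 𝓝[≠] 0, HasSum (fun k => d k * w ^ k) (f w)) :
    f =O[𝓝[≠] 0] fun w => w ^ m := by
  have hseries : HasFPowerSeriesAt (Function.update f 0 (d 0))
      (FormalMultilinearSeries.ofScalars ℂ d) 0 := by
    rw [hasFPowerSeriesAt_iff]
    filter_upwards [eventually_nhdsWithin_iff.1 hf] with w hw
    rcases eq_or_ne w 0 with rfl | h0
    · simpa [FormalMultilinearSeries.coeff_ofScalars] using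
        hasSum_single (f := fun k => (0 : ℂ) ^ k * d k) 0 fun k hk => by simp [hk]
    · simpa [FormalMultilinearSeries.coeff_ofScalars, h0, mul_comm] using hw h0
  have hpartial : ∀ w, (FormalMultilinearSeries.ofScalars ℂ d).partialSum m w = 0 := fun w =>
    Finset.sum_eq_zero fun k hk => by
      rw [FormalMultilinearSeries.ofScalars_apply_eq, hd k (Finset.mem_range.1 hk), zero_smul]
  have hO := (hseries.isBigO_sub_partialSum_pow m).mono (nhdsWithin_le_nhds (s := {0}ᶜ))
  simp only [zero_add, hpartial, sub_zero, ← norm_pow] at hO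
  refine hO.of_norm_right.congr' ?_ .rfl
  filter_upwards [self_mem_nhdsWithin] with w hw using Function.update_of_ne hw _ _

lemma stirlingDefect_isBigO (a : ℝ) (N : ℕ) :
    stirlingDefect a N =O[𝓝[≠] 0] fun w => w ^ (N + 2) := by
  have hsmall : ∀ c : ℂ, ∀ᶠ w : ℂ in 𝓝[≠] 0, ‖c * w‖ < 1 := fun c =>
    nhdsWithin_le_nhds <| (by fun_prop : Continuous fun w : ℂ => ‖c * w‖).continuousAt.eventually_lt
      continuousAt_const (by simp)
  have hquot : (fun w => w⁻¹ * stirlingDefect a N w) =O[𝓝[≠] 0] fun w => w ^ (N + 1) := by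
    refine isBigO_pow_of_hasSum (d := fun k => (stirlingDefectCoeff a N k : ℂ))
      (fun k hk => by simp [stirlingDefectCoeff_eq_zero a (Nat.lt_succ_iff.1 hk)]) ?_
    filter_upwards [hsmall 1, hsmall a, self_mem_nhdsWithin] with w h1 ha h0
    convert! (hasSum_stirlingDefect a N h0 (by simpa using h1) ha).mul_left w⁻¹ using 2 with k
    rw [pow_succ]
    field_simp [show w ≠ 0 from h0]
  refine ((isBigO_refl (fun w : ℂ => w) _).mul hquot).congr' ?_ (.of_forall fun w => by ring)
  filter_upwards [self_mem_nhdsWithin] with w hw using mul_inv_cancel_left₀ hw _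

/-! ### Stirling's formula for `Γ(z + a)` in a sector -/

/-- The closed sector `|arg z| ≤ 3π/4`. It is wider than a half plane, which leaves room to tilt
vertical contours to the left. -/
def sector : Set ℂ := {z | -|z.im| ≤ z.re}

/-- The filter of neighbourhoods of infinity inside `sector`. -/
def atSector : Filter ℂ := cobounded ℂ ⊓ 𝓟 sector

lemma eventually_mem_sector : ∀ᶠ z in atSector, z ∈ sector :=
  mem_inf_of_right (mem_principal_self _)

lemma tendsto_norm_atSector : Tendsto norm atSector atTop :=
  tendsto_norm_cobounded_atTop.mono_left inf_le_left

lemma eventually_ne_atSector (w : ℂ) : ∀ᶠ z in atSector, z ≠ w :=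
  (eventually_ne_cobounded w).filter_mono inf_le_left

lemma add_ofReal_mem_sector {z : ℂ} (hz : z ∈ sector) {t : ℝ} (ht : 0 ≤ t) : z + t ∈ sector := by
  simp only [sector, mem_ofPred_eq, add_im, ofReal_im, add_zero, add_re, ofReal_re] at *
  linarith

lemma tendsto_ofReal_mul_atSector {t : ℝ} (ht : 0 < t) :
    Tendsto (fun z : ℂ => t * z) atSector atSector := by
  refine tendsto_inf.2 ⟨?_, tendsto_principal.2 ?_⟩
  · exact (tendsto_mul_left_cobounded (ofReal_ne_zero.2 ht.ne')).mono_left inf_le_left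
  · filter_upwards [eventually_mem_sector] with z hz
    simp only [sector, mem_ofPred_eq, re_ofReal_mul, im_ofReal_mul, abs_mul, abs_of_pos ht] at *
    nlinarith

lemma norm_add_div_four_le {z : ℂ} (hz : z ∈ sector) {t : ℝ} (ht : 0 ≤ t) :
    (‖z‖ + t) / 4 ≤ ‖z + t‖ := by
  have hz' : -|z.im| ≤ z.re := hz
  refine abs_le_of_sq_le_sq' ?_ (norm_nonneg _) |>.2
  have hsq : ((‖z‖ + t) / 4) ^ 2 ≤ (‖z‖ ^ 2 + t ^ 2) / 8 := by nlinarith [sq_nonneg (‖z‖ - t)]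
  refine hsq.trans ?_
  simp only [Complex.sq_norm, normSq_apply, add_re, add_im, ofReal_re, ofReal_im, add_zero]
  rcases le_or_gt 0 z.re with h | h
  · nlinarith [mul_nonneg h ht, sq_nonneg z.re, sq_nonneg z.im, sq_nonneg t]
  · have : z.re ^ 2 ≤ z.im ^ 2 := by
      rw [← sq_abs z.im]
      nlinarith [abs_nonneg z.im]
    nlinarith [sq_nonneg (t + 2 * z.re)]

lemma add_ofReal_ne_zero {z : ℂ} (hz : z ∈ sector) (h0 : z ≠ 0) {t : ℝ} (ht : 0 ≤ t) :
    z + t ≠ 0 := by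
  refine norm_pos_iff.1 (lt_of_lt_of_le ?_ (norm_add_div_four_le hz ht))
  have := norm_pos_iff.2 h0
  positivity

lemma norm_inv_add_natCast_le {z : ℂ} (hz : z ∈ sector) (h0 : z ≠ 0) (i : ℕ) :
    ‖(z + i)⁻¹‖ ≤ 4 / (‖z‖ + i) := by
  have hpos : 0 < (‖z‖ + i) / 4 := by have := norm_pos_iff.2 h0; positivity
  rw [norm_inv, ← inv_div]
  exact inv_anti₀ hpos (by simpa using norm_add_div_four_le hz i.cast_nonneg)

lemma log_add_one_sub_log {z : ℂ} (hz : z ∈ sector) (h0 : z ≠ 0) :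
    log (z + 1) - log z = log (1 + z⁻¹) := by
  have h1 : z + 1 ≠ 0 := by simpa using add_ofReal_ne_zero hz h0 zero_le_one
  have hexp : exp (log (z + 1) - log z) = 1 + z⁻¹ := by
    rw [exp_sub, exp_log h1, exp_log h0]
    field_simp
  suffices harg : (z + 1).arg - z.arg ∈ Ioc (-Real.pi) Real.pi by
    rw [← hexp, log_exp] <;> rw [sub_im, log_im, log_im]
    exacts [harg.1, harg.2]
  have hz_le := arg_le_pi z
  have hz_gt := neg_pi_lt_arg z
  have hz1_le := arg_le_pi (z + 1)
  have hz1_gt := neg_pi_lt_arg (z + 1)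
  rcases lt_trichotomy z.im 0 with h | h | h
  · have := arg_neg_iff.2 h
    have := arg_neg_iff.2 (show (z + 1).im < 0 by simpa using h)
    constructor <;> linarith
  · have hre : 0 ≤ z.re := by simpa [sector, h] using hz
    have := arg_eq_zero_iff.2 ⟨hre, h⟩
    have := arg_eq_zero_iff (z := z + 1).2 ⟨by simp; linarith, by simpa using h⟩
    constructor <;> linarith [Real.pi_pos]
  · have := arg_nonneg_iff.2 h.le
    have := arg_nonneg_iff.2 (show 0 ≤ (z + 1).im by simpa using h.le)
    have hne : z.arg ≠ Real.pi := fun h' => h.ne' (arg_eq_pi_iff.1 h').2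
    have := lt_of_le_of_ne hz_le hne
    constructor <;> linarith

/-- The Stirling series of `log Γ(z + a)`, truncated after `N` terms. -/
def stirlingLog (a : ℝ) (N : ℕ) (z : ℂ) : ℂ :=
  (z + a - 1 / 2) * log z - z + (Real.log (2 * Real.pi) / 2 : ℝ) +
    ∑ i ∈ Finset.range N, (stirlingCoeff a i : ℂ) * z⁻¹ ^ (i + 1)

/-- The correction `e` with `Γ(z + a) = exp (stirlingLog a N z + e)`: the defects of the truncated
series, summed along `z, z + 1, z + 2, …`. -/
def stirlingError (a : ℝ) (N : ℕ) (z : ℂ) : ℂ := -∑' i : ℕ, stirlingDefect a N (z + i)⁻¹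

lemma exp_stirlingLog_add_one (a : ℝ) (N : ℕ) {z : ℂ} (hz : z ∈ sector) (h0 : z ≠ 0)
    (ha : z + a ≠ 0) :
    exp (stirlingLog a N (z + 1)) * exp (stirlingDefect a N z⁻¹) =
      exp (stirlingLog a N z) * (z + a) := by
  have h1 : z + 1 ≠ 0 := by simpa using add_ofReal_ne_zero hz h0 zero_le_one
  have hza : z + a = z * (1 + a * z⁻¹) := by field_simp
  have hne : 1 + a * z⁻¹ ≠ 0 := fun h => ha (by rw [hza, h, mul_zero])
  have hlog : exp (log z + log (1 + a * z⁻¹)) = z + a := by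
    rw [exp_add, exp_log h0, exp_log hne, hza]
  rw [← hlog, ← exp_add, ← exp_add, stirlingLog, stirlingLog, stirlingDefect,
    show z⁻¹ / (1 + z⁻¹) = (z + 1)⁻¹ by field_simp, inv_inv, ← log_add_one_sub_log hz h0]
  simp only [mul_sub, Finset.sum_sub_distrib]
  congr 1
  ring

lemma Gamma_div_exp_stirlingLog_add_natCast (a : ℝ) (N : ℕ) {z : ℂ} (hz : z ∈ sector) (h0 : z ≠ 0)
    (ha : ∀ n : ℕ, z + a ≠ -n) (n : ℕ) :
    Gamma (z + n + a) / exp (stirlingLog a N (z + n)) =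
      Gamma (z + a) / exp (stirlingLog a N z) *
        exp (∑ i ∈ Finset.range n, stirlingDefect a N (z + i)⁻¹) := by
  induction n with
  | zero => simp
  | succ n ih =>
    have hna : z + n + a ≠ 0 := fun h => ha n (by linear_combination h)
    have hstep := exp_stirlingLog_add_one a N
      (by simpa using add_ofReal_mem_sector hz n.cast_nonneg)
      (by simpa using add_ofReal_ne_zero hz h0 n.cast_nonneg) hna
    rw [Finset.sum_range_succ, exp_add, ← mul_assoc, ← ih]
    push_cast
    rw [← add_assoc, show z + n + 1 + a = z + n + a + 1 by ring, Gamma_add_one _ hna,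
      div_mul_eq_mul_div, div_eq_div_iff (exp_ne_zero _) (exp_ne_zero _)]
    linear_combination (-Gamma (z + n + a)) * hstep

lemma tendsto_natCast_mul_log_one_add_div (z : ℂ) :
    Tendsto (fun n : ℕ => n * log (1 + z / n)) atTop (𝓝 z) := by
  refine tendsto_nat_mul_log_one_add_of_tendsto (tendsto_const_nhds.congr' ?_)
  filter_upwards [eventually_ne_atTop 0] with n hn
  have : (n : ℂ) ≠ 0 := mod_cast hn
  field_simp

lemma tendsto_log_one_add_div_natCast (z : ℂ) :
    Tendsto (fun n : ℕ => log (1 + z / n)) atTop (𝓝 0) := by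
  have h := (tendsto_inv_atTop_nhds_zero_nat (𝕜 := ℂ)).mul (tendsto_natCast_mul_log_one_add_div z)
  rw [zero_mul] at h
  refine h.congr' ?_
  filter_upwards [eventually_ne_atTop 0] with n hn
  have : (n : ℂ) ≠ 0 := mod_cast hn
  field_simp

lemma tendsto_inv_add_natCast (z : ℂ) : Tendsto (fun n : ℕ => (z + n)⁻¹) atTop (𝓝 0) :=
  tendsto_inv₀_cobounded.comp <| (tendsto_const_add_cobounded z).comp
    tendsto_natCast_atTop_cobounded

lemma log_add_natCast_add_one {z : ℂ} {n : ℕ} (hn : n ≠ 0) (h : z + n + 1 ≠ 0) :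
    log (z + n + 1) = Real.log n + log (1 + (z + 1) / n) := by
  have hn0 : (n : ℂ) ≠ 0 := mod_cast hn
  have hfac : z + n + 1 = ((n : ℝ) : ℂ) * (1 + (z + 1) / n) := by
    push_cast
    field_simp
    ring
  rw [hfac, log_ofReal_mul (by positivity) fun h' => h (by rw [hfac, h', mul_zero])]

lemma tendsto_stirlingLog_sub (a : ℝ) (N : ℕ) (z : ℂ) :
    Tendsto (fun n : ℕ => stirlingLog a N (z + n + 1) - ((z + a) * Real.log n +
      ((n + 1 / 2) * Real.log n - n + Real.log (2 * Real.pi) / 2 : ℝ))) atTop (𝓝 0) := by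
  have hsum : Tendsto (fun n : ℕ => ∑ i ∈ Finset.range N,
      (stirlingCoeff a i : ℂ) * (z + 1 + n)⁻¹ ^ (i + 1)) atTop
      (𝓝 (∑ i ∈ Finset.range N, (stirlingCoeff a i : ℂ) * 0 ^ (i + 1))) :=
    tendsto_finsetSum _ fun i _ => ((tendsto_inv_add_natCast (z + 1)).pow (i + 1)).const_mul _
  have hlim := (((tendsto_natCast_mul_log_one_add_div (z + 1)).sub_const (z + 1)).add
    ((tendsto_log_one_add_div_natCast (z + 1)).const_mul (z + a + 1 / 2))).add hsum
  simp only [sub_self, mul_zero, ne_eq, Nat.add_eq_zero_iff, one_ne_zero, and_false,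
    not_false_eq_true, zero_pow, Finset.sum_const_zero, add_zero] at hlim
  refine hlim.congr' ?_
  have hne : ∀ᶠ n : ℕ in atTop, (z + n + 1) ≠ 0 := by
    have htend := (tendsto_const_add_cobounded (z + 1)).comp
      (tendsto_natCast_atTop_cobounded (α := ℂ))
    filter_upwards [htend.eventually (eventually_ne_cobounded 0)] with n hn
    rwa [add_right_comm]
  filter_upwards [eventually_ne_atTop 0, hne] with n hn hzn
  rw [stirlingLog, log_add_natCast_add_one hn hzn, add_right_comm z 1]
  push_cast
  ring

lemma tendsto_factorial_div_exp :
    Tendsto (fun n : ℕ => (n.factorial : ℂ) /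
      exp ((n + 1 / 2) * Real.log n - n + Real.log (2 * Real.pi) / 2 : ℝ)) atTop (𝓝 1) := by
  have hne : ∀ᶠ n : ℕ in atTop, √(2 * n * Real.pi) * (n / Real.exp 1) ^ n ≠ 0 := by
    filter_upwards [eventually_gt_atTop 0] with n hn
    positivity
  have h := ((isEquivalent_iff_tendsto_one hne).1 Stirling.factorial_isEquivalent_stirling).ofReal
  rw [ofReal_one] at h
  refine h.congr' ?_
  filter_upwards [eventually_gt_atTop 0] with n hn
  have hexp : √(2 * n * Real.pi) * (n / Real.exp 1) ^ n =
      Real.exp ((n + 1 / 2) * Real.log n - n + Real.log (2 * Real.pi) / 2) := by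
    have hquot : (n : ℝ) / Real.exp 1 = Real.exp (Real.log n - 1) := by
      rw [Real.exp_sub, Real.exp_log (by positivity)]
    rw [hquot, ← Real.exp_nat_mul, Real.sqrt_eq_rpow, Real.rpow_def_of_pos (by positivity),
      ← Real.exp_add, mul_right_comm, Real.log_mul (by positivity) (by positivity)]
    ring_nf
  rw [Pi.div_apply, hexp]
  push_cast
  rfl

lemma Gamma_add_natCast {s : ℂ} (hs : ∀ n : ℕ, s ≠ -n) (n : ℕ) :
    Gamma (s + n) = (∏ j ∈ Finset.range n, (s + j)) * Gamma s := by
  induction n with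
  | zero => simp
  | succ n ih =>
    rw [Nat.cast_add_one, ← add_assoc, Gamma_add_one _ fun h => hs n (eq_neg_of_add_eq_zero_left h),
      ih, Finset.prod_range_succ]
    ring

lemma tendsto_Gamma_add_natCast_div {s : ℂ} (hs : ∀ n : ℕ, s ≠ -n) :
    Tendsto (fun n : ℕ => Gamma (s + n + 1) / (n ^ s * n.factorial)) atTop (𝓝 1) := by
  have hG : Gamma s ≠ 0 := Gamma_ne_zero hs
  have h := (tendsto_const_nhds (x := Gamma s)).div (GammaSeq_tendsto_Gamma s) hG
  rw [div_self hG] at h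
  refine h.congr fun n => ?_
  rw [add_assoc, ← Nat.cast_add_one, Gamma_add_natCast hs, Pi.div_apply, GammaSeq,
    div_div_eq_mul_div, mul_comm]

lemma tendsto_Gamma_div_exp_stirlingLog (a : ℝ) (N : ℕ) {z : ℂ} (ha : ∀ n : ℕ, z + a ≠ -n) :
    Tendsto (fun n : ℕ => Gamma (z + n + a) / exp (stirlingLog a N (z + n))) atTop (𝓝 1) := by
  rw [← tendsto_add_atTop_iff_nat 1]
  have hexp : Tendsto (fun n : ℕ => exp (-(stirlingLog a N (z + n + 1) - ((z + a) * Real.log n +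
      ((n + 1 / 2) * Real.log n - n + Real.log (2 * Real.pi) / 2 : ℝ))))) atTop (𝓝 1) := by
    simpa only [neg_zero, exp_zero] using (tendsto_stirlingLog_sub a N z).neg.cexp
  have hlim := ((tendsto_Gamma_add_natCast_div ha).mul tendsto_factorial_div_exp).mul hexp
  rw [one_mul, one_mul] at hlim
  refine hlim.congr' ?_
  filter_upwards [eventually_ne_atTop 0] with n hn
  have hfac : (n.factorial : ℂ) ≠ 0 := mod_cast n.factorial_ne_zero
  rw [cpow_def_of_ne_zero (mod_cast hn), natCast_log, neg_sub, exp_sub, exp_add,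
    mul_comm (log (n : ℂ)), Nat.cast_add_one, ← add_assoc, add_right_comm (z + n) 1,
    add_right_comm z]
  field_simp [hfac, exp_ne_zero]

lemma Gamma_eq_exp_stirlingLog_add_stirlingError (a : ℝ) (N : ℕ) {z : ℂ} (hz : z ∈ sector)
    (h0 : z ≠ 0) (ha : ∀ n : ℕ, z + a ≠ -n)
    (hsum : Summable fun i : ℕ => stirlingDefect a N (z + i)⁻¹) :
    Gamma (z + a) = exp (stirlingLog a N z + stirlingError a N z) := by
  have hlim := tendsto_Gamma_div_exp_stirlingLog a N ha
  simp_rw [Gamma_div_exp_stirlingLog_add_natCast a N hz h0 ha] at hlim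
  have hone := tendsto_nhds_unique hlim
    (((continuous_exp.tendsto _).comp hsum.hasSum.tendsto_sum_nat).const_mul _)
  rw [stirlingError, exp_add, exp_neg, ← div_eq_mul_inv, eq_div_iff (exp_ne_zero _)]
  rw [div_mul_eq_mul_div, eq_comm, div_eq_one_iff_eq (exp_ne_zero _)] at hone
  exact hone

lemma sum_range_one_div_sq_le {x : ℝ} (hx : 2 ≤ x) (n : ℕ) :
    ∑ i ∈ Finset.range n, 1 / (x + i) ^ 2 ≤ 2 / x := by
  have htel : ∑ i ∈ Finset.range n, 1 / (x + i) ^ 2 ≤ 1 / (x - 1) - 1 / (x + n - 1) := by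
    induction n with
    | zero => simp
    | succ n ih =>
      have h₁ : 0 < x + n - 1 := by linarith [(Nat.cast_nonneg n : (0 : ℝ) ≤ n)]
      have h₂ : 0 < x + n := by linarith
      have hstep : 1 / (x + n) ^ 2 ≤ 1 / (x + n - 1) - 1 / (x + n) := by
        rw [div_sub_div _ _ h₁.ne' h₂.ne', div_le_div_iff₀ (by positivity) (by positivity)]
        nlinarith
      rw [Finset.sum_range_succ, Nat.cast_add_one, ← add_assoc, add_sub_cancel_right]
      linarith
  have hlast : 0 ≤ 1 / (x + n - 1) :=
    one_div_nonneg.2 (by linarith [(Nat.cast_nonneg n : (0 : ℝ) ≤ n)])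
  have hfirst : 1 / (x - 1) ≤ 2 / x := by
    rw [div_le_div_iff₀ (by linarith) (by linarith)]; linarith
  linarith

lemma eventually_norm_stirlingDefect_le (a : ℝ) (N : ℕ) :
    ∃ C, 0 ≤ C ∧ ∀ᶠ z in atSector, ∀ i : ℕ, ‖stirlingDefect a N (z + i)⁻¹‖ ≤
      C / ‖z‖ ^ N * (1 / (‖z‖ + i) ^ 2) := by
  obtain ⟨C, hC, hbound⟩ := (stirlingDefect_isBigO a N).exists_nonneg
  obtain ⟨δ, hδ, hbound⟩ := Metric.eventually_nhds_iff.1 (eventually_nhdsWithin_iff.1 hbound.bound)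
  refine ⟨C * 4 ^ (N + 2), by positivity, ?_⟩
  filter_upwards [eventually_mem_sector, eventually_ne_atSector 0,
    tendsto_norm_atSector.eventually_gt_atTop (4 / δ)] with z hz h0 hlarge i
  have : 0 < ‖z‖ := norm_pos_iff.2 h0
  have hinv := norm_inv_add_natCast_le hz h0 i
  have hsmall : ‖(z + i)⁻¹‖ < δ := by
    refine hinv.trans_lt ?_
    rw [div_lt_comm₀ (by positivity) hδ]
    linarith
  have hne : z + i ≠ 0 := by simpa using add_ofReal_ne_zero hz h0 i.cast_nonneg
  calc ‖stirlingDefect a N (z + i)⁻¹‖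
    _ ≤ C * ‖(z + i)⁻¹‖ ^ (N + 2) := by
      simpa only [norm_pow] using hbound (by simpa using hsmall) (inv_ne_zero hne)
    _ ≤ C * (4 / (‖z‖ + i)) ^ (N + 2) := by gcongr
    _ = C * 4 ^ (N + 2) * (1 / ((‖z‖ + i) ^ N * (‖z‖ + i) ^ 2)) := by
      rw [div_pow, pow_add (‖z‖ + i)]; ring
    _ ≤ C * 4 ^ (N + 2) * (1 / (‖z‖ ^ N * (‖z‖ + i) ^ 2)) := by
      gcongr
      linarith
    _ = C * 4 ^ (N + 2) / ‖z‖ ^ N * (1 / (‖z‖ + i) ^ 2) := by field_simp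

lemma eventually_sum_norm_stirlingDefect_le (a : ℝ) (N : ℕ) :
    ∃ C, ∀ᶠ z in atSector, ∀ n : ℕ, ∑ i ∈ Finset.range n, ‖stirlingDefect a N (z + i)⁻¹‖ ≤
      C * ‖z⁻¹ ^ (N + 1)‖ := by
  obtain ⟨C, hC, hterm⟩ := eventually_norm_stirlingDefect_le a N
  refine ⟨C * 2, ?_⟩
  filter_upwards [hterm, tendsto_norm_atSector.eventually_ge_atTop 2] with z hz hlarge n
  have : 0 < ‖z‖ := by linarith
  calc ∑ i ∈ Finset.range n, ‖stirlingDefect a N (z + i)⁻¹‖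
    _ ≤ ∑ i ∈ Finset.range n, C / ‖z‖ ^ N * (1 / (‖z‖ + i) ^ 2) :=
      Finset.sum_le_sum fun i _ => hz i
    _ ≤ C / ‖z‖ ^ N * (2 / ‖z‖) := by
      rw [← Finset.mul_sum]
      gcongr
      exact sum_range_one_div_sq_le hlarge n
    _ = C * 2 * ‖z⁻¹ ^ (N + 1)‖ := by rw [norm_pow, norm_inv, inv_pow, pow_succ]; field_simp

lemma stirlingError_isBigO (a : ℝ) (N : ℕ) :
    stirlingError a N =O[atSector] fun z => z⁻¹ ^ (N + 1) := by
  obtain ⟨C, hC⟩ := eventually_sum_norm_stirlingDefect_le a N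
  refine .of_bound C ?_
  filter_upwards [hC] with z hz
  have hsum := summable_of_sum_range_le (fun _ => norm_nonneg _) hz
  rw [stirlingError, norm_neg]
  exact (norm_tsum_le_tsum_norm hsum).trans (hsum.tsum_le_of_sum_range_le hz)

theorem eventually_Gamma_eq_exp_stirlingLog_add_stirlingError (a : ℝ) (N : ℕ) :
    ∀ᶠ z in atSector, Gamma (z + a) = exp (stirlingLog a N z + stirlingError a N z) := by
  obtain ⟨C, hC⟩ := eventually_sum_norm_stirlingDefect_le a N
  have hlarge := tendsto_norm_atSector.eventually_gt_atTop (4 * |a|)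
  filter_upwards [eventually_mem_sector, eventually_ne_atSector 0, hlarge, hC] with z hz h0 hza hsum
  refine Gamma_eq_exp_stirlingLog_add_stirlingError a N hz h0 (fun n h => ?_)
    (summable_of_sum_range_le (fun _ => norm_nonneg _) hsum).of_norm
  have hn := norm_add_div_four_le hz n.cast_nonneg
  rw [show z + (n : ℝ) = -(a : ℂ) by push_cast; linear_combination h, norm_neg, norm_real,
    Real.norm_eq_abs] at hn
  linarith [(Nat.cast_nonneg n : (0 : ℝ) ≤ n)]

/-! ### The asymptotic expansion of the gamma ratio -/

-- `T e^{-Q}` has derivative `(T' - Q' T) e^{-Q}`, which vanishes to order `N` at `0`.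
lemma exp_eval_sub_eval_isBigO {Q T : Polynomial ℂ} {N : ℕ} (hQ : Q.eval 0 = 0)
    (hT : T.eval 0 = 1)
    (hdvd : Polynomial.X ^ N ∣ T.derivative - Q.derivative * T) :
    (fun w : ℂ => exp (Q.eval w) - T.eval w) =O[𝓝 0] fun w => w ^ (N + 1) := by
  set g : ℂ → ℂ := fun w => T.eval w * exp (-Q.eval w) with hg
  have hderiv : deriv g = fun w => (T.derivative - Q.derivative * T).eval w * exp (-Q.eval w) := by
    funext w
    have h : HasDerivAt g _ w := (T.hasDerivAt w).mul (Q.hasDerivAt w).neg.cexp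
    rw [h.deriv, Polynomial.eval_sub, Polynomial.eval_mul, Pi.neg_apply]
    ring
  have hana : AnalyticAt ℂ g 0 :=
    Differentiable.analyticAt (T.differentiable.mul Q.differentiable.neg.cexp) 0
  have hord : (N : ℕ∞) ≤ analyticOrderAt (deriv g) 0 := by
    obtain ⟨R, hR⟩ := hdvd
    refine (natCast_le_analyticOrderAt hana.deriv).2 ⟨fun w => R.eval w * exp (-Q.eval w),
      Differentiable.analyticAt (R.differentiable.mul Q.differentiable.neg.cexp) 0,
      .of_forall fun w => ?_⟩
    simp [hderiv, hR, mul_assoc]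
  have hord' : ((N + 1 : ℕ) : ℕ∞) ≤ analyticOrderAt (g · - g 0) 0 := by
    rw [← hana.analyticOrderAt_deriv_add_one, Nat.cast_succ]
    gcongr
  obtain ⟨h, hh, heq⟩ :=
    (natCast_le_analyticOrderAt (hana.sub analyticAt_const)).1 hord'
  have hbdd : (fun w => -(exp (Q.eval w) * h w)) =O[𝓝 0] fun _ => (1 : ℂ) :=
    ((Q.continuous.cexp.continuousAt.mul hh.continuousAt).neg).isBigO_one ℂ
  refine (hbdd.mul (isBigO_refl (fun w : ℂ => w ^ (N + 1)) _)).congr' ?_ (by simp)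
  filter_upwards [heq] with w hw
  have hw' : T.eval w * exp (-Q.eval w) - 1 = w ^ (N + 1) * h w := by
    simpa [hg, hQ, hT] using hw
  have hexp : exp (Q.eval w) * exp (-Q.eval w) = 1 := by rw [← exp_add]; simp
  linear_combination exp (Q.eval w) * hw' - T.eval w * hexp

lemma exp_sum_sub_sum_isBigO {c l : ℕ → ℂ} (h0 : l 0 = 1)
    (hl : ∀ r : ℕ, ((r : ℂ) + 1) * l (r + 1) = ∑ i ∈ Finset.range (r + 1), c i * l (r - i))
    (N : ℕ) :
    (fun w : ℂ => exp (∑ i ∈ Finset.range N, c i / (i + 1) * w ^ (i + 1)) -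
      ∑ r ∈ Finset.range (N + 1), l r * w ^ r) =O[𝓝 0] fun w => w ^ (N + 1) := by
  set Q : Polynomial ℂ := ∑ i ∈ Finset.range N,
    Polynomial.C (c i / (i + 1)) * Polynomial.X ^ (i + 1) with hQ
  set T : Polynomial ℂ := ∑ r ∈ Finset.range (N + 1),
    Polynomial.C (l r) * Polynomial.X ^ r with hT
  have hQ' {i : ℕ} (hi : i < N) : Q.derivative.coeff i = c i := by
    have : (i : ℂ) + 1 ≠ 0 := by exact_mod_cast i.succ_ne_zero
    simp only [hQ, Polynomial.coeff_derivative, Polynomial.finsetSum_coeff,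
      Polynomial.coeff_C_mul_X_pow, add_left_inj]
    simp [hi, this]
  have hT' {r : ℕ} (hr : r < N + 1) : T.coeff r = l r := by
    simp only [hT, Polynomial.finsetSum_coeff, Polynomial.coeff_C_mul_X_pow]
    simp [hr]
  have hdvd : Polynomial.X ^ N ∣ T.derivative - Q.derivative * T := by
    refine Polynomial.X_pow_dvd_iff.2 fun d hd => ?_
    rw [Polynomial.coeff_sub, Polynomial.coeff_derivative, hT' (by lia), Polynomial.coeff_mul,
      Finset.Nat.sum_antidiagonal_eq_sum_range_succ_mk, sub_eq_zero, mul_comm, hl]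
    refine Finset.sum_congr rfl fun i hi => ?_
    have := Finset.mem_range.1 hi
    rw [hQ' (by lia), hT' (by lia)]
  have h := exp_eval_sub_eval_isBigO (Q := Q) (T := T) (by simp [hQ, Polynomial.eval_finsetSum])
    (by rw [← Polynomial.coeff_zero_eq_eval_zero, hT' N.succ_pos, h0]) hdvd
  simpa [hQ, hT, Polynomial.eval_finsetSum] using h

variable {p q : ℕ}

lemma lCoeff_zero (A a : Fin p → ℝ) (B b : Fin q → ℝ) : lCoeff A a B b 0 = 1 := by
  rw [lCoeff]

lemma succ_mul_lCoeff_succ (A a : Fin p → ℝ) (B b : Fin q → ℝ) (r : ℕ) :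
    ((r : ℝ) + 1) * lCoeff A a B b (r + 1) =
      ∑ i ∈ Finset.range (r + 1), qCoeff A a B b (i + 1) * lCoeff A a B b (r - i) := by
  rw [lCoeff, ← Finset.sum_range (n := r + 1)
    (fun i => qCoeff A a B b (i + 1) * lCoeff A a B b (r - i))]
  field_simp

lemma rho_eq_exp {A : Fin p → ℝ} {B : Fin q → ℝ} (hA : ∀ k, 0 < A k) (hB : ∀ j, 0 < B j) :
    rho A B = Real.exp (∑ k, A k * Real.log (A k) - ∑ j, B j * Real.log (B j)) := by
  simp_rw [rho, Real.exp_sub, Real.exp_sum, div_eq_mul_inv, ← Finset.prod_inv_distrib,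
    fun k => Real.rpow_def_of_pos (hA k) (A k), fun j => Real.rpow_def_of_pos (hB j) (-B j),
    ← Real.exp_neg, mul_neg, mul_comm (Real.log _)]

lemma rho_pos {A : Fin p → ℝ} {B : Fin q → ℝ} (hA : ∀ k, 0 < A k) (hB : ∀ j, 0 < B j) :
    0 < rho A B := by
  rw [rho_eq_exp hA hB]
  exact Real.exp_pos _

lemma rho_swap {A : Fin p → ℝ} {B : Fin q → ℝ} (hA : ∀ k, 0 < A k) (hB : ∀ j, 0 < B j) :
    rho B A = (rho A B)⁻¹ := by
  rw [rho_eq_exp hA hB, rho_eq_exp hB hA, ← Real.exp_neg, neg_sub]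

lemma nu_eq_exp {A : Fin p → ℝ} {B : Fin q → ℝ} (hA : ∀ k, 0 < A k) (hB : ∀ j, 0 < B j)
    (a : Fin p → ℝ) (b : Fin q → ℝ) :
    nu A a B b = Real.exp
      (∑ k, ((a k - 1 / 2) * Real.log (A k) + Real.log (2 * Real.pi) / 2) -
        ∑ j, ((b j - 1 / 2) * Real.log (B j) + Real.log (2 * Real.pi) / 2)) := by
  have hprodA : ∏ k, A k ^ (a k - 1 / 2) = Real.exp (∑ k, (a k - 1 / 2) * Real.log (A k)) := by
    simp_rw [Real.exp_sum, fun k => Real.rpow_def_of_pos (hA k) (a k - 1 / 2), mul_comm]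
  have hprodB : ∏ j, B j ^ (1 / 2 - b j) = Real.exp (-∑ j, (b j - 1 / 2) * Real.log (B j)) := by
    simp_rw [← Finset.sum_neg_distrib, Real.exp_sum,
      fun j => Real.rpow_def_of_pos (hB j) (1 / 2 - b j), ← neg_mul, neg_sub, mul_comm]
  rw [nu, hprodA, hprodB, Real.rpow_def_of_pos Real.two_pi_pos, ← Real.exp_add, ← Real.exp_add,
    Finset.sum_add_distrib, Finset.sum_add_distrib]
  simp only [Finset.sum_const, Finset.card_univ, Fintype.card_fin, nsmul_eq_mul]
  ring_nf

lemma stirlingLog_ofReal_mul (a : ℝ) (N : ℕ) {t : ℝ} (ht : 0 < t) {s : ℂ} (hs : s ≠ 0) :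
    stirlingLog a N (t * s) = t * (s * log s - s) + (a - 1 / 2 : ℝ) * log s +
      (t * Real.log t : ℝ) * s + ((a - 1 / 2) * Real.log t + Real.log (2 * Real.pi) / 2 : ℝ) +
      ∑ i ∈ Finset.range N, (stirlingCoeff a i / t ^ (i + 1) : ℝ) * s⁻¹ ^ (i + 1) := by
  have hterm (i : ℕ) : (stirlingCoeff a i : ℂ) * ((t : ℂ) * s)⁻¹ ^ (i + 1) =
      (stirlingCoeff a i / t ^ (i + 1) : ℝ) * s⁻¹ ^ (i + 1) := by
    push_cast
    rw [mul_inv, mul_pow, inv_pow, div_eq_mul_inv, mul_assoc]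
  simp_rw [stirlingLog, log_ofReal_mul ht hs, hterm]
  push_cast
  ring

lemma sum_stirlingLog_mul (N : ℕ) {A : Fin p → ℝ} (hA : ∀ k, 0 < A k) (a : Fin p → ℝ) {s : ℂ}
    (hs : s ≠ 0) :
    ∑ k, stirlingLog (a k) N (A k * s) = (∑ k, A k : ℝ) * (s * log s - s) +
      (∑ k, a k - p / 2 : ℝ) * log s + (∑ k, A k * Real.log (A k) : ℝ) * s +
      (∑ k, ((a k - 1 / 2) * Real.log (A k) + Real.log (2 * Real.pi) / 2) : ℝ) +
      ∑ i ∈ Finset.range N, (∑ k, stirlingCoeff (a k) i / A k ^ (i + 1) : ℝ) * s⁻¹ ^ (i + 1) := by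
  have hhalf : ∑ k, a k - p / 2 = ∑ k, (a k - 1 / 2) := by
    simp [Finset.sum_sub_distrib, div_eq_mul_inv]
  simp_rw [stirlingLog_ofReal_mul _ N (hA _) hs, hhalf, ofReal_sum, Finset.sum_mul]
  rw [Finset.sum_comm (s := Finset.range N)]
  simp only [Finset.sum_add_distrib]

lemma sum_stirlingCoeff_sub (A a : Fin p → ℝ) (B b : Fin q → ℝ) (i : ℕ) :
    ∑ k, stirlingCoeff (a k) i / A k ^ (i + 1) - ∑ j, stirlingCoeff (b j) i / B j ^ (i + 1) =
      qCoeff A a B b (i + 1) / (i + 1) := by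
  have hsum {r : ℕ} (A a : Fin r → ℝ) : ∑ k, stirlingCoeff (a k) i / A k ^ (i + 1) =
      (-1) ^ i / (((i : ℝ) + 1) * (i + 2)) * ∑ k, bernoulliPoly (i + 1 + 1) (a k) /
        A k ^ (i + 1) := by
    rw [Finset.mul_sum]
    refine Finset.sum_congr rfl fun k _ => ?_
    rw [stirlingCoeff]
    ring
  rw [hsum, hsum, qCoeff]
  push_cast
  have h1 : (i : ℝ) + 1 ≠ 0 := by positivity
  have h2 : (i : ℝ) + 2 ≠ 0 := by positivity
  have h3 : (i : ℝ) + 1 + 1 ≠ 0 := by positivity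
  rw [pow_succ (-1 : ℝ), pow_succ (-1 : ℝ)]
  field_simp
  ring

lemma sum_stirlingError_mul_isBigO (N : ℕ) {A : Fin p → ℝ} (hA : ∀ k, 0 < A k)
    (a : Fin p → ℝ) :
    (fun s => ∑ k, stirlingError (a k) N (A k * s)) =O[atSector] fun s => s⁻¹ ^ (N + 1) := by
  refine IsBigO.fun_sum fun k _ => ?_
  have h := (stirlingError_isBigO (a k) N).comp_tendsto (tendsto_ofReal_mul_atSector (hA k))
  refine h.trans ((isBigO_const_mul_self ((A k : ℂ)⁻¹ ^ (N + 1)) (fun s : ℂ => s⁻¹ ^ (N + 1))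
    _).congr_left fun s => ?_)
  simp [mul_pow, mul_comm]

lemma eventually_prod_Gamma_eq_exp (N : ℕ) {A : Fin p → ℝ} (hA : ∀ k, 0 < A k)
    (a : Fin p → ℝ) :
    ∀ᶠ s in atSector, ∏ k, Gamma (A k * s + a k) =
      exp (∑ k, stirlingLog (a k) N (A k * s) + ∑ k, stirlingError (a k) N (A k * s)) := by
  have h : ∀ᶠ s in atSector, ∀ k, Gamma (A k * s + a k) =
      exp (stirlingLog (a k) N (A k * s) + stirlingError (a k) N (A k * s)) :=
    eventually_all.2 fun k => (tendsto_ofReal_mul_atSector (hA k)).eventually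
      (eventually_Gamma_eq_exp_stirlingLog_add_stirlingError (a k) N)
  filter_upwards [h] with s hs
  rw [← Finset.sum_add_distrib, exp_sum]
  exact Finset.prod_congr rfl fun k _ => hs k

lemma sum_stirlingLog_mul_sub {A a : Fin p → ℝ} {B b : Fin q → ℝ} (hA : ∀ k, 0 < A k)
    (hB : ∀ j, 0 < B j) (hΔ : Delta A B = 0) {m : ℕ} (hμ : mu a b = -(m : ℝ)) (N : ℕ) {s : ℂ}
    (hs : s ≠ 0) :
    ∑ k, stirlingLog (a k) N (A k * s) - ∑ j, stirlingLog (b j) N (B j * s) =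
      m * log s + Real.log (rho A B) * s + Real.log (nu A a B b) +
        ∑ i ∈ Finset.range N, (qCoeff A a B b (i + 1) : ℂ) / (i + 1) * s⁻¹ ^ (i + 1) := by
  have hsum : ∑ j, B j = ∑ k, A k := sub_eq_zero.1 hΔ
  have hm : (m : ℝ) = ∑ k, a k - p / 2 - (∑ j, b j - q / 2) := by rw [mu] at hμ; linarith
  have hm' : (m : ℂ) = (∑ k, a k - p / 2 - (∑ j, b j - q / 2) : ℝ) := by rw [← hm, ofReal_natCast]
  have hq (i : ℕ) : (qCoeff A a B b (i + 1) : ℂ) / (i + 1) =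
      (∑ k, stirlingCoeff (a k) i / A k ^ (i + 1) - ∑ j, stirlingCoeff (b j) i / B j ^ (i + 1) :
        ℝ) := by
    rw [sum_stirlingCoeff_sub]
    push_cast
    rfl
  simp_rw [sum_stirlingLog_mul N hA a hs, sum_stirlingLog_mul N hB b hs, hsum, hm', hq,
    rho_eq_exp hA hB, nu_eq_exp hA hB, Real.log_exp, ofReal_sub, sub_mul, Finset.sum_sub_distrib]
  ring

lemma nu_pos {A : Fin p → ℝ} {B : Fin q → ℝ} (hA : ∀ k, 0 < A k) (hB : ∀ j, 0 < B j)
    (a : Fin p → ℝ) (b : Fin q → ℝ) : 0 < nu A a B b := by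
  rw [nu_eq_exp hA hB]
  exact Real.exp_pos _

lemma eventually_gammaRatio_mul_rho_cpow_neg {A a : Fin p → ℝ} {B b : Fin q → ℝ}
    (hA : ∀ k, 0 < A k) (hB : ∀ j, 0 < B j) (hΔ : Delta A B = 0) {m : ℕ}
    (hμ : mu a b = -(m : ℝ)) (N : ℕ) :
    ∀ᶠ s in atSector, gammaRatio A a B b s * (rho A B : ℂ) ^ (-s) =
      nu A a B b * s ^ m *
        exp (∑ i ∈ Finset.range N, (qCoeff A a B b (i + 1) : ℂ) / (i + 1) * s⁻¹ ^ (i + 1)) *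
        exp (∑ k, stirlingError (a k) N (A k * s) - ∑ j, stirlingError (b j) N (B j * s)) := by
  filter_upwards [eventually_prod_Gamma_eq_exp N hA a, eventually_prod_Gamma_eq_exp N hB b,
    eventually_ne_atSector 0] with s hGA hGB hs
  have hρ := rho_pos hA hB
  have hpow : s ^ m = exp (m * log s) := by rw [exp_nat_mul, exp_log hs]
  have hν : (nu A a B b : ℂ) = exp (Real.log (nu A a B b)) := by
    rw [← ofReal_exp, Real.exp_log (nu_pos hA hB a b)]
  rw [gammaRatio, hGA, hGB, ← exp_sub, cpow_def_of_ne_zero (mod_cast hρ.ne'),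
    ← ofReal_log hρ.le, hpow, hν]
  simp only [← exp_add]
  congr 1
  linear_combination sum_stirlingLog_mul_sub hA hB hΔ hμ N hs

/-- The polynomial `ν ∑ₖ l_{m-k} sᵏ`, the part of `ρ^(-s)` times the gamma ratio that does not
decay at infinity. -/
def principalPart (A a : Fin p → ℝ) (B b : Fin q → ℝ) (m : ℕ) (s : ℂ) : ℂ :=
  nu A a B b * ∑ k ∈ Finset.range (m + 1), (lCoeff A a B b (m - k) : ℂ) * s ^ k

lemma pow_mul_sum_mul_inv_pow (l : ℕ → ℂ) (m : ℕ) {s : ℂ} (hs : s ≠ 0) :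
    s ^ m * ∑ r ∈ Finset.range (m + 1), l r * s⁻¹ ^ r =
      ∑ k ∈ Finset.range (m + 1), l (m - k) * s ^ k := by
  rw [← Finset.sum_range_reflect, Finset.mul_sum]
  refine Finset.sum_congr rfl fun k hk => ?_
  have hk' : k ≤ m := Nat.lt_succ_iff.1 (Finset.mem_range.1 hk)
  rw [show m + 1 - 1 - k = m - k by lia, inv_pow, ← pow_mul_pow_sub s hk']
  field_simp

/-- `ρ^(-s)` times the gamma ratio, minus its principal part. -/
def remainder (A a : Fin p → ℝ) (B b : Fin q → ℝ) (m : ℕ) (s : ℂ) : ℂ :=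
  gammaRatio A a B b s * (rho A B : ℂ) ^ (-s) - principalPart A a B b m s

theorem remainder_isBigO {A a : Fin p → ℝ} {B b : Fin q → ℝ} (hA : ∀ k, 0 < A k)
    (hB : ∀ j, 0 < B j) (hΔ : Delta A B = 0) {m : ℕ} (hμ : mu a b = -(m : ℝ)) :
    remainder A a B b m =O[atSector] fun s => s⁻¹ := by
  set T : ℂ → ℂ := fun w => ∑ r ∈ Finset.range (m + 1), (lCoeff A a B b r : ℂ) * w ^ r
  set E : ℂ → ℂ := fun w => exp (∑ i ∈ Finset.range m,
    (qCoeff A a B b (i + 1) : ℂ) / (i + 1) * w ^ (i + 1))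
  set e : ℂ → ℂ := fun s => ∑ k, stirlingError (a k) m (A k * s) -
    ∑ j, stirlingError (b j) m (B j * s)
  have hinv : Tendsto (fun s : ℂ => s⁻¹) atSector (𝓝 0) :=
    tendsto_inv₀_cobounded.mono_left inf_le_left
  have he_bigO : e =O[atSector] fun s => s⁻¹ ^ (m + 1) :=
    (sum_stirlingError_mul_isBigO m hA a).sub (sum_stirlingError_mul_isBigO m hB b)
  have he_tendsto : Tendsto e atSector (𝓝 0) :=
    he_bigO.trans_tendsto (by simpa using hinv.pow (m + 1))
  have hexp : (fun s => exp (e s) - 1) =O[atSector] fun s => s⁻¹ ^ (m + 1) := by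
    have h : (fun z : ℂ => exp z - 1) =O[𝓝 0] fun z => z := by
      simpa using (hasDerivAt_exp 0).isBigO_sub
    exact (h.comp_tendsto he_tendsto).trans he_bigO
  have hE_bdd : (fun s : ℂ => E s⁻¹) =O[atSector] fun _ => (1 : ℂ) :=
    ((show Continuous E by fun_prop).tendsto 0 |>.comp hinv).isBigO_one ℂ
  have hTE : (fun s : ℂ => E s⁻¹ - T s⁻¹) =O[atSector] fun s => s⁻¹ ^ (m + 1) :=
    (exp_sum_sub_sum_isBigO (c := fun i => (qCoeff A a B b (i + 1) : ℂ))
      (l := fun r => (lCoeff A a B b r : ℂ)) (by simp [lCoeff_zero])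
      (fun r => mod_cast succ_mul_lCoeff_succ A a B b r) m).comp_tendsto hinv
  have hsum : (fun s => E s⁻¹ * (exp (e s) - 1) + (E s⁻¹ - T s⁻¹)) =O[atSector]
      fun s => s⁻¹ ^ (m + 1) := by
    simpa using ((hE_bdd.mul hexp).congr_right fun s => one_mul _).add hTE
  refine ((isBigO_const_mul_self (nu A a B b : ℂ) (fun s : ℂ => s ^ m) atSector).mul
    hsum).congr' ?_ ?_
  · filter_upwards [eventually_gammaRatio_mul_rho_cpow_neg hA hB hΔ hμ m,
      eventually_ne_atSector 0] with s hs hs0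
    rw [remainder, hs, principalPart,
      ← pow_mul_sum_mul_inv_pow (fun r => (lCoeff A a B b r : ℂ)) m hs0]
    ring
  · filter_upwards [eventually_ne_atSector 0] with s hs
    rw [inv_pow, pow_succ]
    field_simp

/-! ### Analyticity and growth of the gamma ratio -/

/-- The plane slit along `(-∞, γ]`. -/
def slit (γ : ℝ) : Set ℂ := {z | z - γ ∈ slitPlane}

lemma mem_slit {γ : ℝ} {z : ℂ} : z ∈ slit γ ↔ γ < z.re ∨ z.im ≠ 0 := by
  simp [slit, mem_slitPlane_iff]

lemma isOpen_slit (γ : ℝ) : IsOpen (slit γ) :=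
  isOpen_slitPlane.preimage (continuous_id.sub continuous_const)

lemma neg_div_le_gam (A a : Fin p → ℝ) (k : Fin p) : -(a k / A k) ≤ gam A a :=
  neg_le_neg (ciInf_le (finite_range _).bddBelow k)

lemma mul_add_ne_neg_natCast {A a γ : ℝ} (hA : 0 < A) (hγ : -(a / A) ≤ γ) {z : ℂ}
    (hz : z ∈ slit γ) (n : ℕ) : (A : ℂ) * z + a ≠ -n := by
  intro h
  rcases mem_slit.1 hz with hre | him
  · have hn : A * z.re + a = -n := by simpa using congrArg re h
    have hpos : 0 < z.re + a / A := by linarith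
    have := mul_pos hA hpos
    rw [mul_add, mul_div_cancel₀ _ hA.ne'] at this
    linarith [n.cast_nonneg (α := ℝ)]
  · have : A * z.im = 0 := by simpa using congrArg im h
    exact mul_ne_zero hA.ne' him this

lemma differentiableOn_gammaRatio {A a : Fin p → ℝ} (B b : Fin q → ℝ) (hA : ∀ k, 0 < A k) :
    DifferentiableOn ℂ (gammaRatio A a B b) (slit (gam A a)) := by
  have heq : gammaRatio A a B b = fun z => (∏ k, Gamma ((A k : ℂ) * z + a k)) *
      ∏ j, (Gamma ((B j : ℂ) * z + b j))⁻¹ := by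
    ext z
    rw [gammaRatio, div_eq_mul_inv, Finset.prod_inv_distrib]
  rw [heq]
  refine fun z hz => (DifferentiableAt.mul ?_ ?_).differentiableWithinAt
  · refine DifferentiableAt.fun_finsetProd fun k _ => ?_
    have hpole := mul_add_ne_neg_natCast (hA k) (neg_div_le_gam A a k) hz
    exact (differentiableAt_Gamma _ hpole).comp z (by fun_prop)
  · refine DifferentiableAt.fun_finsetProd fun j _ => ?_
    exact (differentiable_one_div_Gamma _).comp z (by fun_prop)

lemma differentiable_principalPart (A a : Fin p → ℝ) (B b : Fin q → ℝ) (m : ℕ) :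
    Differentiable ℂ (principalPart A a B b m) := by
  unfold principalPart
  fun_prop

lemma differentiableOn_gammaRatio_mul_rho_cpow_neg {A a : Fin p → ℝ} {B : Fin q → ℝ}
    (b : Fin q → ℝ) (hA : ∀ k, 0 < A k) (hB : ∀ j, 0 < B j) :
    DifferentiableOn ℂ (fun s => gammaRatio A a B b s * (rho A B : ℂ) ^ (-s))
      (slit (gam A a)) := by
  have hρ : (rho A B : ℂ) ≠ 0 := ofReal_ne_zero.2 (rho_pos hA hB).ne'
  exact (differentiableOn_gammaRatio B b hA).mul fun z _ =>
    (DifferentiableAt.const_cpow (by fun_prop) (.inl hρ)).differentiableWithinAt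

lemma differentiableOn_remainder {A a : Fin p → ℝ} {B : Fin q → ℝ} (b : Fin q → ℝ)
    (hA : ∀ k, 0 < A k) (hB : ∀ j, 0 < B j) (m : ℕ) :
    DifferentiableOn ℂ (remainder A a B b m) (slit (gam A a)) :=
  (differentiableOn_gammaRatio_mul_rho_cpow_neg b hA hB).sub
    (differentiable_principalPart A a B b m).differentiableOn

lemma principalPart_isBigO (A a : Fin p → ℝ) (B b : Fin q → ℝ) (m : ℕ) :
    principalPart A a B b m =O[cobounded ℂ] fun s => s ^ m := by
  refine IsBigO.const_mul_left (IsBigO.fun_sum fun k hk => ?_) _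
  exact (isBigO_pow_pow_cobounded_of_le (Finset.mem_range_succ_iff.1 hk)).const_mul_left _

theorem gammaRatio_mul_rho_cpow_neg_isBigO_atSector {A a : Fin p → ℝ} {B b : Fin q → ℝ}
    (hA : ∀ k, 0 < A k) (hB : ∀ j, 0 < B j) (hΔ : Delta A B = 0) {m : ℕ}
    (hμ : mu a b = -(m : ℝ)) :
    (fun s : ℂ => gammaRatio A a B b s * (rho A B : ℂ) ^ (-s)) =O[atSector] fun s => s ^ m := by
  have hinv : (fun s : ℂ => s⁻¹) =O[cobounded ℂ] fun s => s ^ m :=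
    ((tendsto_inv₀_cobounded.isBigO_one ℂ).trans
      (by simpa using isBigO_pow_pow_cobounded_of_le (R := ℂ) m.zero_le))
  have hrem := (remainder_isBigO hA hB hΔ hμ).trans (hinv.mono inf_le_left)
  refine (hrem.add ((principalPart_isBigO A a B b m).mono inf_le_left)).congr_left fun s => ?_
  rw [remainder, sub_add_cancel]

lemma norm_sin_le (w : ℂ) : ‖sin w‖ ≤ Real.exp |w.im| := by
  have htri := norm_sub_le (exp (-w * I)) (exp (w * I))
  rw [norm_exp, norm_exp] at htri
  simp only [neg_mul, neg_re, mul_I_re, neg_neg] at htri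
  have hpos : Real.exp w.im ≤ Real.exp |w.im| := Real.exp_le_exp.2 (le_abs_self _)
  have hneg : Real.exp (-w.im) ≤ Real.exp |w.im| := Real.exp_le_exp.2 (neg_le_abs _)
  rw [sin, norm_div, norm_mul, norm_I, mul_one, Complex.norm_two, neg_mul]
  linarith

lemma le_norm_sin {w : ℂ} {v : ℝ} (hv : v ≤ |w.im|) :
    (1 - Real.exp (-2 * v)) / 2 * Real.exp |w.im| ≤ ‖sin w‖ := by
  have htri : Real.exp |w.im| - Real.exp (-|w.im|) ≤ ‖exp (-w * I) - exp (w * I)‖ := by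
    have hneg : ‖exp (-w * I)‖ = Real.exp w.im := by simp [norm_exp]
    have hpos : ‖exp (w * I)‖ = Real.exp (-w.im) := by simp [norm_exp]
    rcases abs_cases w.im with ⟨h, _⟩ | ⟨h, _⟩
    · rw [h, ← hneg, ← hpos]
      exact norm_sub_norm_le _ _
    · rw [h, neg_neg, ← hneg, ← hpos, norm_sub_rev]
      exact norm_sub_norm_le _ _
  have hexp : Real.exp (-|w.im|) ≤ Real.exp (-2 * v) * Real.exp |w.im| := by
    rw [← Real.exp_add]
    exact Real.exp_le_exp.2 (by linarith)
  rw [sin, norm_div, norm_mul, norm_I, mul_one, Complex.norm_two]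
  linarith

lemma im_pi_mul_affine (A a : ℝ) (z : ℂ) :
    ((Real.pi : ℂ) * (A * z + a)).im = Real.pi * A * z.im := by
  simp [mul_assoc]

lemma pi_div_sin_isBigO {A : ℝ} (hA : 0 < A) (a : ℝ) {φ : ℝ} (hφ : 0 < φ) :
    (fun z : ℂ => Real.pi / sin (Real.pi * (A * z + a))) =O[𝓟 {z | φ ≤ |z.im|}]
      fun z => Real.exp (-(Real.pi * A * |z.im|)) := by
  have hδ : 0 < (1 - Real.exp (-2 * (Real.pi * A * φ))) / 2 := by
    have : 0 < Real.pi * A * φ := by positivity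
    have : Real.exp (-2 * (Real.pi * A * φ)) < 1 := Real.exp_lt_one_iff.2 (by linarith)
    linarith
  refine IsBigO.of_bound (Real.pi / ((1 - Real.exp (-2 * (Real.pi * A * φ))) / 2)) ?_
  refine eventually_principal.2 fun z (hz : φ ≤ |z.im|) => ?_
  have habs : |((Real.pi : ℂ) * (A * z + a)).im| = Real.pi * A * |z.im| := by
    rw [im_pi_mul_affine, abs_mul, abs_of_pos (by positivity)]
  have hsin := le_norm_sin (w := Real.pi * (A * z + a)) (v := Real.pi * A * φ)
    (by rw [habs]; gcongr)
  rw [habs] at hsin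
  rw [norm_div, norm_real, Real.norm_of_nonneg Real.pi_pos.le, Real.norm_of_nonneg (by positivity),
    Real.exp_neg, ← div_eq_mul_inv, div_div]
  gcongr

lemma inv_pi_div_sin_isBigO {B : ℝ} (hB : 0 < B) (b : ℝ) :
    (fun z : ℂ => (Real.pi / sin (Real.pi * (B * z + b)))⁻¹) =O[⊤]
      fun z => Real.exp (Real.pi * B * |z.im|) := by
  refine IsBigO.of_bound Real.pi⁻¹ (.of_forall fun z => ?_)
  have hsin := norm_sin_le (Real.pi * (B * z + b))
  rw [im_pi_mul_affine, abs_mul, abs_of_pos (by positivity : 0 < Real.pi * B)] at hsin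
  rw [inv_div, norm_div, norm_real, Real.norm_of_nonneg Real.pi_pos.le,
    Real.norm_of_nonneg (by positivity), div_eq_inv_mul]
  gcongr

lemma Gamma_eq_pi_div_sin_mul {z : ℂ} (hz : z.im ≠ 0) :
    Gamma z = Real.pi / sin (Real.pi * z) * (Gamma (1 - z))⁻¹ := by
  have hne : Gamma (1 - z) ≠ 0 := Gamma_ne_zero fun n hn => hz (by simpa using congrArg im hn)
  rw [← Gamma_mul_Gamma_one_sub, mul_inv_cancel_right₀ hne]

lemma prod_Gamma_reflect {A : Fin p → ℝ} (hA : ∀ k, 0 < A k) (a : Fin p → ℝ) {z : ℂ}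
    (hz : z.im ≠ 0) :
    ∏ k, Gamma ((A k : ℂ) * z + a k) =
      (∏ k, (Real.pi / sin (Real.pi * ((A k : ℂ) * z + a k)))) *
        (∏ k, Gamma ((A k : ℂ) * (-z) + ((1 - a k : ℝ) : ℂ)))⁻¹ := by
  rw [← Finset.prod_inv_distrib, ← Finset.prod_mul_distrib]
  refine Finset.prod_congr rfl fun k _ => ?_
  rw [Gamma_eq_pi_div_sin_mul (by simpa using ⟨(hA k).ne', hz⟩)]
  congr 3
  push_cast
  ring

lemma gammaRatio_reflect {A : Fin p → ℝ} {B : Fin q → ℝ} (hA : ∀ k, 0 < A k)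
    (hB : ∀ j, 0 < B j) (a : Fin p → ℝ) (b : Fin q → ℝ) {z : ℂ} (hz : z.im ≠ 0) :
    gammaRatio A a B b z =
      (∏ k, (Real.pi / sin (Real.pi * ((A k : ℂ) * z + a k)))) *
      (∏ j, (Real.pi / sin (Real.pi * ((B j : ℂ) * z + b j)))⁻¹) *
      gammaRatio B (fun j => 1 - b j) A (fun k => 1 - a k) (-z) := by
  rw [gammaRatio, gammaRatio, prod_Gamma_reflect hA a hz, prod_Gamma_reflect hB b hz,
    div_eq_mul_inv, mul_inv, inv_inv, Finset.prod_inv_distrib]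
  ring

lemma prod_pi_div_sin_isBigO_one {A : Fin p → ℝ} {B : Fin q → ℝ} (hA : ∀ k, 0 < A k)
    (hB : ∀ j, 0 < B j) (hΔ : Delta A B = 0) (a : Fin p → ℝ) (b : Fin q → ℝ) {φ : ℝ}
    (hφ : 0 < φ) :
    (fun z : ℂ => (∏ k, (Real.pi / sin (Real.pi * ((A k : ℂ) * z + a k)))) *
      ∏ j, (Real.pi / sin (Real.pi * ((B j : ℂ) * z + b j)))⁻¹) =O[𝓟 {z | φ ≤ |z.im|}]
      fun _ => (1 : ℝ) := by
  have hprodA := IsBigO.finsetProd fun k (_ : k ∈ Finset.univ) =>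
    pi_div_sin_isBigO (hA k) (a k) hφ
  have hprodB := IsBigO.finsetProd fun j (_ : j ∈ Finset.univ) =>
    (inv_pi_div_sin_isBigO (hB j) (b j)).mono (le_top : 𝓟 {z : ℂ | φ ≤ |z.im|} ≤ ⊤)
  refine (hprodA.mul hprodB).congr_right fun z => ?_
  simp only [← Real.exp_sum, Finset.sum_neg_distrib, ← Finset.sum_mul, ← Finset.mul_sum]
  rw [sub_eq_zero.1 hΔ, ← Real.exp_add, neg_add_cancel, Real.exp_zero]

/-- The part of the half plane `Re z ≤ c` at distance at least `φ` from the real axis. -/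
def leftRegion (c φ : ℝ) : Set ℂ := {z | z.re ≤ c ∧ φ ≤ |z.im|}

lemma tendsto_neg_leftRegion (c φ : ℝ) :
    Tendsto Neg.neg (cobounded ℂ ⊓ 𝓟 (leftRegion c φ)) atSector := by
  refine tendsto_inf.2 ⟨tendsto_neg_cobounded.mono_left inf_le_left, tendsto_principal.2 ?_⟩
  filter_upwards [mem_inf_of_right (mem_principal_self _),
    mem_inf_of_left (tendsto_norm_cobounded_atTop.eventually_gt_atTop (2 * |c|))] with z hz hnorm
  change -|(-z).im| ≤ (-z).re
  rw [neg_im, neg_re, abs_neg]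
  by_contra! hlt
  have hre : |z.re| = z.re := abs_of_pos (by linarith [abs_nonneg z.im])
  linarith [abs_nonneg z.im, norm_le_abs_re_add_abs_im z, le_abs_self c, hz.1]

theorem gammaRatio_mul_rho_cpow_neg_isBigO_leftRegion {A a : Fin p → ℝ} {B b : Fin q → ℝ}
    (hA : ∀ k, 0 < A k) (hB : ∀ j, 0 < B j) (hΔ : Delta A B = 0) {m : ℕ}
    (hμ : mu a b = -(m : ℝ)) (c : ℝ) {φ : ℝ} (hφ : 0 < φ) :
    (fun z : ℂ => gammaRatio A a B b z * (rho A B : ℂ) ^ (-z))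
      =O[cobounded ℂ ⊓ 𝓟 (leftRegion c φ)] fun z => z ^ m := by
  have hΔ' : Delta B A = 0 := by rw [Delta] at *; linarith
  have hμ' : mu (fun j => 1 - b j) (fun k => 1 - a k) = -(m : ℝ) := by
    rw [← hμ, mu, mu]
    simp only [Finset.sum_sub_distrib, Finset.sum_const, Finset.card_univ, Fintype.card_fin,
      nsmul_eq_mul, mul_one]
    ring
  have hle : cobounded ℂ ⊓ 𝓟 (leftRegion c φ) ≤ 𝓟 {z | φ ≤ |z.im|} :=
    inf_le_right.trans (principal_mono.2 fun z hz => hz.2)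
  have hrefl := ((prod_pi_div_sin_isBigO_one hA hB hΔ a b hφ).mono hle).mul
    ((gammaRatio_mul_rho_cpow_neg_isBigO_atSector hB hA hΔ' hμ').comp_tendsto
      (tendsto_neg_leftRegion c φ)).norm_right
  refine (hrefl.congr' ?_ ?_).of_norm_right
  · filter_upwards [hle (mem_principal_self _)] with z hz
    have hrho : (rho B A : ℂ) ^ z = (rho A B : ℂ) ^ (-z) := by
      rw [rho_swap hA hB, ofReal_inv, inv_cpow _ _ (by
        rw [arg_ofReal_of_nonneg (rho_pos hA hB).le]; exact Real.pi_ne_zero.symm), cpow_neg]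
    rw [gammaRatio_reflect hA hB a b (abs_pos.1 (hφ.trans_le hz))]
    simp only [Function.comp_apply, neg_neg, hrho]
    ring
  · exact .of_forall fun z => by simp

/-! ### Integrals along rays -/

/-- The contour integral of `f` along the ray `z₀ + r ω`, `r ≥ 0`. -/
def rayIntegral (f : ℂ → ℂ) (z₀ ω : ℂ) : ℂ := (∫ r in Ioi (0 : ℝ), f (z₀ + r * ω)) * ω

lemma tendsto_ray (z₀ : ℂ) {ω : ℂ} (hω : ω ≠ 0) :
    Tendsto (fun r : ℝ => z₀ + r * ω) atTop (cobounded ℂ) :=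
  (tendsto_const_add_cobounded z₀).comp
    ((tendsto_mul_right_cobounded hω).comp (RCLike.tendsto_ofReal_atTop_cobounded ℂ))

lemma ray_inv_isBigO (z₀ : ℂ) {ω : ℂ} (hω : ω ≠ 0) :
    (fun r : ℝ => (z₀ + r * ω)⁻¹) =O[atTop] fun r => r⁻¹ := by
  have hconst : (fun _ : ℝ => z₀) =O[atTop] fun r : ℝ => z₀ + r * ω :=
    (isLittleO_const_left.2
      (.inr (tendsto_norm_cobounded_atTop.comp (tendsto_ray z₀ hω)))).isBigO
  have hmul : (fun r : ℝ => (r : ℂ) * ω) =O[atTop] fun r : ℝ => z₀ + r * ω :=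
    ((isBigO_refl _ _).sub hconst).congr_left fun r => add_sub_cancel_left _ _
  have hid : (fun r : ℝ => r) =O[atTop] fun r : ℝ => z₀ + r * ω := by
    refine (hmul.const_mul_left ω⁻¹).norm_left.congr_left (fun r => ?_) |>.of_norm_left
    rw [mul_comm, mul_inv_cancel_right₀ hω, norm_real]
  refine hid.inv_rev ?_
  filter_upwards [eventually_ne_atTop 0] with r hr h using absurd h hr

lemma ray_inv_sq_isBigO (z₀ : ℂ) {ω : ℂ} (hω : ω ≠ 0) :
    (fun r : ℝ => ((z₀ + r * ω) ^ 2)⁻¹) =O[atTop] fun r => r ^ (-2 : ℝ) := by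
  refine ((ray_inv_isBigO z₀ hω).pow 2).congr' (.of_forall fun r => inv_pow _ _) ?_
  filter_upwards [eventually_ge_atTop 0] with r hr
  rw [Real.rpow_neg hr, Real.rpow_ofNat, inv_pow]

lemma integrableOn_ray {f : ℂ → ℂ} {T : Set ℂ} {z₀ ω : ℂ} (hω : ω ≠ 0)
    (hf : ContinuousOn (fun r : ℝ => f (z₀ + r * ω)) (Ici 0))
    (hO : f =O[cobounded ℂ ⊓ 𝓟 T] fun z => (z ^ 2)⁻¹)
    (hT : ∀ᶠ r : ℝ in atTop, z₀ + r * ω ∈ T) :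
    IntegrableOn (fun r : ℝ => f (z₀ + r * ω)) (Ioi 0) := by
  have htendsto := tendsto_inf.2 ⟨tendsto_ray z₀ hω, tendsto_principal.2 hT⟩
  refine IntegrableOn.mono_set ?_ Ioi_subset_Ici_self
  exact (hf.locallyIntegrableOn measurableSet_Ici).integrableOn_of_isBigO_atTop
    ((hO.comp_tendsto htendsto).trans (ray_inv_sq_isBigO z₀ hω))
    (integrableAtFilter_rpow_atTop_iff.2 (by norm_num))

lemma integral_comp_affine_eq_sub {F f : ℂ → ℂ} {z₀ ω : ℂ} {x₁ x₂ : ℝ}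
    (hF : ∀ t ∈ uIcc x₁ x₂, HasDerivAt F (f (z₀ + (t : ℂ) * ω)) (z₀ + (t : ℂ) * ω))
    (hf : IntervalIntegrable (fun t : ℝ => f (z₀ + t * ω)) volume x₁ x₂) :
    (∫ t in x₁..x₂, f (z₀ + (t : ℂ) * ω)) * ω =
      F (z₀ + (x₂ : ℂ) * ω) - F (z₀ + (x₁ : ℂ) * ω) := by
  rw [← intervalIntegral.integral_mul_const]
  refine intervalIntegral.integral_eq_sub_of_hasDerivAt (f := fun t : ℝ => F (z₀ + (t : ℂ) * ω))
    (fun t ht => ?_) (hf.mul_const ω)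
  have hline : HasDerivAt (fun t : ℝ => z₀ + (t : ℂ) * ω) ω t := by
    simpa using (ofRealCLM.hasDerivAt (x := t)).mul_const ω |>.const_add z₀
  exact (hF t ht).comp_of_eq t hline rfl

lemma tendsto_primitive_ray {F f : ℂ → ℂ} {z₀ ω : ℂ}
    (hF : ∀ r : ℝ, 0 ≤ r → HasDerivAt F (f (z₀ + r * ω)) (z₀ + r * ω))
    (hf : IntegrableOn (fun r : ℝ => f (z₀ + r * ω)) (Ioi 0)) :
    Tendsto (fun r : ℝ => F (z₀ + r * ω)) atTop (𝓝 (F z₀ + rayIntegral f z₀ ω)) := by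
  have hlim := (intervalIntegral_tendsto_integral_Ioi 0 hf tendsto_id).mul_const ω
  refine (hlim.const_add (F z₀)).congr' ?_
  filter_upwards [eventually_ge_atTop 0] with r hr
  rw [id, integral_comp_affine_eq_sub (fun t ht => hF t (uIcc_of_le hr ▸ ht).1)
    ((intervalIntegrable_iff_integrableOn_Ioc_of_le hr).2 (hf.mono_set Ioc_subset_Ioi_self))]
  simp

lemma primitive_ray_sub_isBigO {F f : ℂ → ℂ} {T : Set ℂ}
    (hf : f =O[cobounded ℂ ⊓ 𝓟 T] fun z => (z ^ 2)⁻¹) {z₁ ω₁ z₂ ω₂ : ℂ}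
    (hchord : ∀ᶠ r : ℝ in atTop, ∀ z ∈ segment ℝ (z₁ + r * ω₁) (z₂ + r * ω₂),
      HasDerivAt F (f z) z ∧ z ∈ T ∧ r ≤ 4 * ‖z‖) :
    (fun r : ℝ => F (z₁ + r * ω₁) - F (z₂ + r * ω₂)) =O[atTop] fun r => r⁻¹ := by
  obtain ⟨C, hC, hbound⟩ := hf.exists_nonneg
  obtain ⟨R, -, hR⟩ := ((hasBasis_cobounded_norm.inf_principal T).eventually_iff).1 hbound.bound
  refine IsBigO.of_bound (16 * C * (1 + ‖ω₁ - ω₂‖)) ?_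
  filter_upwards [hchord, eventually_ge_atTop (4 * R), eventually_ge_atTop ‖z₁ - z₂‖,
    eventually_gt_atTop 0] with r hr hrR hrz hr0
  have hf_le : ∀ z ∈ segment ℝ (z₁ + r * ω₁) (z₂ + r * ω₂), ‖f z‖ ≤ 16 * C / r ^ 2 := by
    intro z hz
    obtain ⟨-, hzT, hrz⟩ := hr z hz
    refine (hR ⟨by simp only [mem_ofPred_eq]; linarith, hzT⟩).trans ?_
    calc C * ‖(z ^ 2)⁻¹‖ ≤ C * ((r / 4) ^ 2)⁻¹ := by rw [norm_inv, norm_pow]; gcongr; linarith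
      _ = 16 * C / r ^ 2 := by field_simp; norm_num
  have hlength : ‖z₁ + r * ω₁ - (z₂ + r * ω₂)‖ ≤ r * (1 + ‖ω₁ - ω₂‖) := by
    calc ‖z₁ + r * ω₁ - (z₂ + r * ω₂)‖ = ‖(z₁ - z₂) + r * (ω₁ - ω₂)‖ := by ring_nf
      _ ≤ ‖z₁ - z₂‖ + r * ‖ω₁ - ω₂‖ := by
        simpa [abs_of_pos hr0] using norm_add_le (z₁ - z₂) (r * (ω₁ - ω₂))
      _ ≤ r * (1 + ‖ω₁ - ω₂‖) := by linarith
  calc ‖F (z₁ + r * ω₁) - F (z₂ + r * ω₂)‖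
      ≤ 16 * C / r ^ 2 * ‖z₁ + r * ω₁ - (z₂ + r * ω₂)‖ :=
        (convex_segment _ _).norm_image_sub_le_of_norm_hasDerivWithin_le
          (fun z hz => (hr z hz).1.hasDerivWithinAt) hf_le
          (right_mem_segment ℝ _ _) (left_mem_segment ℝ _ _)
    _ ≤ 16 * C / r ^ 2 * (r * (1 + ‖ω₁ - ω₂‖)) := by gcongr
    _ = 16 * C * (1 + ‖ω₁ - ω₂‖) * ‖r⁻¹‖ := by
        rw [norm_inv, Real.norm_of_nonneg hr0.le]
        field_simp

lemma rayIntegral_sub_rayIntegral {F f : ℂ → ℂ} {S T : Set ℂ} (hS : IsOpen S)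
    (hF : ∀ z ∈ S, HasDerivAt F (f z) z) (hf : f =O[cobounded ℂ ⊓ 𝓟 T] fun z => (z ^ 2)⁻¹)
    {z₁ ω₁ z₂ ω₂ : ℂ} (hω₁ : ω₁ ≠ 0) (hω₂ : ω₂ ≠ 0)
    (hS₁ : ∀ r : ℝ, 0 ≤ r → z₁ + r * ω₁ ∈ S) (hS₂ : ∀ r : ℝ, 0 ≤ r → z₂ + r * ω₂ ∈ S)
    (hchord : ∀ᶠ r : ℝ in atTop, ∀ z ∈ segment ℝ (z₁ + r * ω₁) (z₂ + r * ω₂),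
      z ∈ S ∧ z ∈ T ∧ r ≤ 4 * ‖z‖) :
    rayIntegral f z₁ ω₁ - rayIntegral f z₂ ω₂ = F z₂ - F z₁ := by
  have hcont : ContinuousOn f S :=
    (IsExactOn.differentiableOn hS ⟨F, hF⟩).continuousOn
  have hlim {z₀ ω : ℂ} (hω : ω ≠ 0) (hray : ∀ r : ℝ, 0 ≤ r → z₀ + r * ω ∈ S)
      (hT : ∀ᶠ r : ℝ in atTop, z₀ + r * ω ∈ T) :=
    tendsto_primitive_ray (fun r hr => hF _ (hray r hr))
      (integrableOn_ray hω (hcont.comp (by fun_prop) hray) hf hT)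
  have hlim₁ := hlim hω₁ hS₁ (hchord.mono fun r h => (h _ (left_mem_segment ℝ _ _)).2.1)
  have hlim₂ := hlim hω₂ hS₂ (hchord.mono fun r h => (h _ (right_mem_segment ℝ _ _)).2.1)
  have hzero := (primitive_ray_sub_isBigO hf (hchord.mono fun r h z hz =>
    ⟨hF z (h z hz).1, (h z hz).2⟩)).trans_tendsto tendsto_inv_atTop_zero
  linear_combination tendsto_nhds_unique (hlim₁.sub hlim₂) hzero

/-! ### Deformation of the loops -/

lemma mul_exp_isBigO_inv_sq {g : ℂ → ℂ} {l : Filter ℂ} (hl : l ≤ cobounded ℂ) {m : ℕ}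
    (hg : g =O[l] fun z => z ^ m) {κ t C : ℝ} (hκ : 0 < κ / t)
    (hbound : ∀ᶠ z in l, ‖z‖ ≤ C - t * z.re) :
    (fun z => g z * exp (κ * z)) =O[l] fun z => (z ^ 2)⁻¹ := by
  have ht : t ≠ 0 := fun h => by simp [h] at hκ
  have hexp : (fun z : ℂ => exp (κ * z)) =O[l] fun z => Real.exp (-(κ / t) * ‖z‖) := by
    refine IsBigO.of_bound (Real.exp (κ / t * C)) ?_
    filter_upwards [hbound] with z hz
    rw [norm_exp, re_ofReal_mul, Real.norm_of_nonneg (Real.exp_pos _).le, ← Real.exp_add]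
    refine Real.exp_le_exp.2 ?_
    calc κ * z.re = κ / t * (t * z.re) := by field_simp
      _ ≤ κ / t * (C - ‖z‖) := mul_le_mul_of_nonneg_left (by linarith) hκ.le
      _ = κ / t * C + -(κ / t) * ‖z‖ := by ring
  have hdecay : (fun z : ℂ => Real.exp (-(κ / t) * ‖z‖)) =O[l] fun z => (‖z‖ ^ (m + 2))⁻¹ := by
    refine ((isLittleO_exp_neg_mul_rpow_atTop hκ (-(m + 2 : ℕ))).isBigO.comp_tendsto
      (tendsto_norm_cobounded_atTop.mono_left hl)).congr_right fun z => ?_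
    rw [Function.comp_apply, Real.rpow_neg (norm_nonneg z), Real.rpow_natCast]
  refine (hg.norm_norm.mul (hexp.trans hdecay).norm_left).congr'
    (.of_forall fun z => (norm_mul _ _).symm) ?_ |>.of_norm_norm
  filter_upwards [hl (eventually_ne_cobounded 0)] with z hz
  rw [norm_pow, norm_inv, norm_pow, pow_add]
  field_simp

lemma isExactOn_slit {γ : ℝ} {f : ℂ → ℂ} (hf : DifferentiableOn ℂ f (slit γ)) :
    IsExactOn f (slit γ) := by
  set S : Set ℂ := {w | w.im ∈ Ioo (-Real.pi) Real.pi}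
  have hS_open : IsOpen S := isOpen_Ioo.preimage continuous_im
  have hS_convex : Convex ℝ S := (convex_Ioo (-Real.pi) Real.pi).linear_preimage imLm
  have hexp : ∀ w ∈ S, (γ : ℂ) + exp w ∈ slit γ := by
    intro w hw
    have hlog : (exp w).arg = w.im := by rw [← log_im, log_exp hw.1 hw.2.le]
    change (γ : ℂ) + exp w - γ ∈ slitPlane
    rw [add_sub_cancel_left, mem_slitPlane_iff_arg, hlog]
    exact ⟨hw.2.ne, exp_ne_zero _⟩
  obtain ⟨g, hg⟩ := hS_convex.exists_forall_hasDerivWithinAt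
    ((hf.comp (differentiable_exp.const_add _).differentiableOn hexp).mul
      differentiable_exp.differentiableOn)
  refine ⟨fun z => g (log (z - γ)), fun z (hz : z - γ ∈ slitPlane) => ?_⟩
  have hmem : log (z - γ) ∈ S := by
    rw [mem_ofPred_eq, log_im]
    exact ⟨neg_pi_lt_arg _, (arg_le_pi _).lt_of_ne (mem_slitPlane_iff_arg.1 hz).1⟩
  have hcomp := ((hg _ hmem).hasDerivAt (hS_open.mem_nhds hmem)).comp z
    (((hasDerivAt_id z).sub_const (γ : ℂ)).clog hz)
  simpa [Function.comp_def, exp_log (slitPlane_ne_zero hz), slitPlane_ne_zero hz] using hcomp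

lemma integral_Ici_eq_rayIntegral (f : ℂ → ℂ) (c φ : ℝ) :
    ∫ t in Ici c, f (t + φ * I) = rayIntegral f (c + φ * I) 1 := by
  rw [rayIntegral, mul_one, integral_Ici_eq_integral_Ioi,
    ← (measurePreserving_add_left volume c).setIntegral_preimage_emb
      (measurableEmbedding_addLeft c) (fun t : ℝ => f (t + φ * I)),
    preimage_const_add_Ioi, sub_self]
  congr! 3 with r
  push_cast
  ring

lemma integral_Iic_eq_neg_rayIntegral (f : ℂ → ℂ) (c φ : ℝ) :
    ∫ t in Iic c, f (t + φ * I) = -rayIntegral f (c + φ * I) (-1) := by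
  have hsub := (Measure.measurePreserving_sub_left volume c).setIntegral_preimage_emb
    (measurableEmbedding_subLeft c) (fun t : ℝ => f (t + φ * I)) (Iic c)
  rw [rayIntegral, mul_neg_one, neg_neg, ← integral_Ici_eq_integral_Ioi, ← hsub,
    preimage_const_sub_Iic, sub_self]
  congr! 3 with r
  push_cast
  ring

lemma I_mul_integral_eq_sub {γ c : ℝ} (hc : γ < c) {F f : ℂ → ℂ}
    (hF : ∀ z ∈ slit γ, HasDerivAt F (f z) z) (φ₁ φ₂ : ℝ) :
    I * (∫ t in φ₁..φ₂, f (c + t * I)) = F (c + φ₂ * I) - F (c + φ₁ * I) := by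
  have hmem (t : ℝ) : (c : ℂ) + t * I ∈ slit γ := mem_slit.2 (.inl (by simpa using hc))
  have hf : ContinuousOn f (slit γ) :=
    (IsExactOn.differentiableOn (isOpen_slit γ) ⟨F, hF⟩).continuousOn
  rw [mul_comm]
  exact integral_comp_affine_eq_sub (fun t _ => hF _ (hmem t))
    ((hf.comp_continuous (f := fun t : ℝ => (c : ℂ) + t * I) (by fun_prop)
      hmem).intervalIntegrable _ _)

lemma rightLoopIntegral_eq_rayIntegral {γ c : ℝ} (hc : γ < c) {F f : ℂ → ℂ}
    (hF : ∀ z ∈ slit γ, HasDerivAt F (f z) z) (φ₁ φ₂ : ℝ) :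
    rightLoopIntegral c φ₁ φ₂ f = rayIntegral f (c + φ₂ * I) 1 + F (c + φ₂ * I) -
      (rayIntegral f (c + φ₁ * I) 1 + F (c + φ₁ * I)) := by
  rw [rightLoopIntegral, integral_Ici_eq_rayIntegral, integral_Ici_eq_rayIntegral,
    I_mul_integral_eq_sub hc hF]
  ring

lemma leftLoopIntegral_eq_rayIntegral {γ c : ℝ} (hc : γ < c) {F f : ℂ → ℂ}
    (hF : ∀ z ∈ slit γ, HasDerivAt F (f z) z) (φ₁ φ₂ : ℝ) :
    leftLoopIntegral c φ₁ φ₂ f = rayIntegral f (c + φ₂ * I) (-1) + F (c + φ₂ * I) -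
      (rayIntegral f (c + φ₁ * I) (-1) + F (c + φ₁ * I)) := by
  rw [leftLoopIntegral, integral_Iic_eq_neg_rayIntegral, integral_Iic_eq_neg_rayIntegral,
    I_mul_integral_eq_sub hc hF]
  ring

lemma eventually_right_chord (c φ₁ φ₂ : ℝ) : ∀ᶠ r : ℝ in atTop,
    ∀ z ∈ segment ℝ ((c : ℂ) + φ₂ * I + r * 1) ((c : ℂ) + φ₁ * I + r * 1),
      z.re = c + r ∧ z ∈ sector ∧ ‖z‖ ≤ |φ₁| + |φ₂| - -1 * z.re ∧ r ≤ 4 * ‖z‖ := by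
  filter_upwards [eventually_ge_atTop 0, eventually_ge_atTop (2 * |c|)] with r hr hrc z hz
  have hre : z.re = c + r := by
    have hend (φ : ℝ) : ((c : ℂ) + φ * I + r * 1).re = c + r := by simp
    obtain ⟨s, t, -, -, hst, rfl⟩ := hz
    rw [add_re, smul_re, smul_re, hend, hend, ← add_smul, hst, one_smul]
  have him : |z.im| ≤ |φ₁| + |φ₂| := by
    obtain ⟨s, t, hs, ht, hst, rfl⟩ := hz
    calc |(s • ((c : ℂ) + φ₂ * I + r * 1) + t • ((c : ℂ) + φ₁ * I + r * 1)).im|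
        = |s * φ₂ + t * φ₁| := by simp
      _ ≤ s * |φ₂| + t * |φ₁| := by
        simpa [abs_mul, abs_of_nonneg, hs, ht] using abs_add_le (s * φ₂) (t * φ₁)
      _ ≤ |φ₁| + |φ₂| := by nlinarith [abs_nonneg φ₁, abs_nonneg φ₂]
  have hc_le := neg_abs_le c
  have hnorm := norm_le_abs_re_add_abs_im z
  rw [abs_of_nonneg (by linarith : 0 ≤ z.re)] at hnorm
  refine ⟨hre, ?_, by linarith, by linarith [re_le_norm z]⟩
  change -|z.im| ≤ z.re
  linarith [abs_nonneg z.im]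

theorem rightLoopIntegral_mul_exp_eq_zero {γ c : ℝ} (hc : γ < c) {g : ℂ → ℂ}
    (hd : DifferentiableOn ℂ g (slit γ)) {m : ℕ} (hg : g =O[atSector] fun z => z ^ m) {κ : ℝ}
    (hκ : κ < 0) (φ₁ φ₂ : ℝ) :
    rightLoopIntegral c φ₁ φ₂ (fun z => g z * exp (κ * z)) = 0 := by
  have hd_exp : DifferentiableOn ℂ (fun z => g z * exp (κ * z)) (slit γ) := hd.mul (by fun_prop)
  obtain ⟨F, hF⟩ := isExactOn_slit hd_exp
  have hdecay := mul_exp_isBigO_inv_sq inf_le_left (hg.mono (inf_le_inf_left _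
    (principal_mono.2 (inter_subset_left (t := {z | ‖z‖ ≤ |φ₁| + |φ₂| - -1 * z.re})))))
    (by linarith : 0 < κ / -1) (mem_inf_of_right fun z hz => hz.2)
  have hray (φ : ℝ) : ∀ r : ℝ, 0 ≤ r → (c : ℂ) + φ * I + r * 1 ∈ slit γ := fun r hr =>
    mem_slit.2 (.inl (by simp; linarith))
  rw [rightLoopIntegral_eq_rayIntegral hc hF]
  linear_combination rayIntegral_sub_rayIntegral (isOpen_slit γ) hF hdecay one_ne_zero
    one_ne_zero (hray φ₂) (hray φ₁) (by
      filter_upwards [eventually_right_chord c φ₁ φ₂, eventually_ge_atTop 0] with r hr hr0 z hz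
      obtain ⟨hre, hsector, hnorm, hle⟩ := hr z hz
      exact ⟨mem_slit.2 (.inl (by linarith)), ⟨hsector, hnorm⟩, hle⟩)

/-- The direction `-1 + 2 ε i`; for `ε = ±1` it points into the left half plane but stays inside
`sector`. -/
def angleDir (ε : ℝ) : ℂ := -1 + 2 * ε * I

/-- The integral of `f` along the boundary of the angle with vertex `c` and sides in the directions
`-1 ± 2i`, traversed upwards. -/
def angleIntegral (c : ℝ) (f : ℂ → ℂ) : ℂ :=
  rayIntegral f c (angleDir 1) - rayIntegral f c (angleDir (-1))

lemma angleDir_ne_zero (ε : ℝ) : angleDir ε ≠ 0 := fun h => by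
  simpa [angleDir] using congrArg re h

lemma re_add_mul_angleDir (c ε r : ℝ) : ((c : ℂ) + r * angleDir ε).re = c - r := by
  simp [angleDir, sub_eq_add_neg]

lemma im_add_mul_angleDir (c ε r : ℝ) : ((c : ℂ) + r * angleDir ε).im = 2 * ε * r := by
  simp [angleDir, mul_comm]

lemma add_mul_angleDir_mem_slit {γ c ε : ℝ} (hc : γ < c) (hε : ε ≠ 0) {r : ℝ} (hr : 0 ≤ r) :
    c + r * angleDir ε ∈ slit γ := by
  rcases hr.eq_or_lt with rfl | hr
  · exact mem_slit.2 (.inl (by simpa using hc))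
  · exact mem_slit.2 (.inr (by simp [angleDir, hr.ne', hε]))

lemma leftRegion_subset_slit {c φ : ℝ} (hφ : 0 < φ) (γ : ℝ) : leftRegion c φ ⊆ slit γ :=
  fun _ hz => mem_slit.2 (.inr (abs_pos.1 (hφ.trans_le hz.2)))

lemma eventually_left_chord (c c' : ℝ) {φ ε : ℝ} (hε : |ε| = 1) (hφ : 0 < ε * φ) :
    ∀ᶠ r : ℝ in atTop,
      ∀ z ∈ segment ℝ ((c : ℂ) + φ * I + r * (-1)) ((c' : ℂ) + r * angleDir ε),
        z ∈ leftRegion 0 (ε * φ) ∧ ‖z‖ ≤ 2 * max c c' + ε * φ - 3 * z.re ∧ r ≤ 4 * ‖z‖ := by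
  set M := max c c'
  filter_upwards [eventually_ge_atTop (ε * φ), eventually_ge_atTop (2 * |M|)] with r hr hrM z hz
  have hr0 : 0 < r := hφ.trans_le hr
  have hM := le_abs_self M
  have hre : z.re ≤ M - r := by
    obtain ⟨s, t, hs, ht, hst, rfl⟩ := hz
    have hsM := mul_le_mul_of_nonneg_left (le_max_left c c') hs
    have htM := mul_le_mul_of_nonneg_left (le_max_right c c') ht
    have hstart : ((c : ℂ) + φ * I + r * (-1)).re = c - r := by simp [sub_eq_add_neg]
    rw [add_re, smul_re, smul_re, hstart, re_add_mul_angleDir, smul_eq_mul, smul_eq_mul]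
    linear_combination hsM + htM + (M - r) * hst
  have him : |z.im| ∈ Icc (ε * φ) (ε * φ + 2 * r) := by
    obtain ⟨s, t, hs, ht, hst, rfl⟩ := hz
    have hε_sq : ε * ε = 1 := by rw [← abs_mul_abs_self, hε, one_mul]
    have heq : |(s • ((c : ℂ) + φ * I + r * (-1)) + t • ((c' : ℂ) + r * angleDir ε)).im| =
        s * (ε * φ) + t * (2 * r) := by
      rw [← abs_of_nonneg (by positivity : 0 ≤ s * (ε * φ) + t * (2 * r)), ← one_mul |_|, ← hε,
        ← abs_mul]
      congr 1
      have hstart : ((c : ℂ) + φ * I + r * (-1)).im = φ := by simp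
      rw [add_im, smul_im, smul_im, hstart, im_add_mul_angleDir, smul_eq_mul, smul_eq_mul]
      linear_combination (2 * t * r) * hε_sq
    rw [heq]
    constructor <;> nlinarith
  have hnorm := norm_le_abs_re_add_abs_im z
  have hre_norm := abs_re_le_norm z
  rw [abs_of_nonpos (by linarith : z.re ≤ 0)] at hnorm hre_norm
  exact ⟨⟨by linarith, him.1⟩, by linarith [him.2], by linarith⟩

theorem leftLoopIntegral_mul_exp_eq_angleIntegral {γ c c' : ℝ} (hc : γ < c) (hc' : γ < c')
    {φ₁ φ₂ : ℝ} (hφ₁ : φ₁ < 0) (hφ₂ : 0 < φ₂) {g : ℂ → ℂ}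
    (hd : DifferentiableOn ℂ g (slit γ)) {m : ℕ}
    (hg : ∀ φ > 0, g =O[cobounded ℂ ⊓ 𝓟 (leftRegion 0 φ)] fun z => z ^ m) {κ : ℝ} (hκ : 0 < κ) :
    leftLoopIntegral c φ₁ φ₂ (fun z => g z * exp (κ * z)) =
      angleIntegral c' fun z => g z * exp (κ * z) := by
  have hd_exp : DifferentiableOn ℂ (fun z => g z * exp (κ * z)) (slit γ) := hd.mul (by fun_prop)
  obtain ⟨F, hF⟩ := isExactOn_slit hd_exp
  have hside {φ ε : ℝ} (hε : |ε| = 1) (hφ : 0 < ε * φ) :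
      rayIntegral (fun z => g z * exp (κ * z)) (c + φ * I) (-1) + F (c + φ * I) =
        rayIntegral (fun z => g z * exp (κ * z)) c' (angleDir ε) + F c' := by
    have hdecay := mul_exp_isBigO_inv_sq inf_le_left ((hg (ε * φ) hφ).mono (inf_le_inf_left _
      (principal_mono.2 (inter_subset_left
        (t := {z | ‖z‖ ≤ 2 * max c c' + ε * φ - 3 * z.re})))))
      (by positivity : 0 < κ / 3) (mem_inf_of_right fun z hz => hz.2)
    have hray : ∀ r : ℝ, 0 ≤ r → (c : ℂ) + φ * I + r * (-1) ∈ slit γ := fun r _ =>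
      mem_slit.2 (.inr (by simpa using right_ne_zero_of_mul hφ.ne'))
    linear_combination rayIntegral_sub_rayIntegral (isOpen_slit γ) hF hdecay
      (neg_ne_zero.2 one_ne_zero) (angleDir_ne_zero ε) hray
      (fun r hr => add_mul_angleDir_mem_slit hc' (left_ne_zero_of_mul hφ.ne') hr) (by
        filter_upwards [eventually_left_chord c c' hε hφ] with r hr z hz
        obtain ⟨hleft, hnorm, hle⟩ := hr z hz
        exact ⟨leftRegion_subset_slit hφ γ hleft, ⟨hleft, hnorm⟩, hle⟩)
  rw [leftLoopIntegral_eq_rayIntegral hc hF, angleIntegral, hside (ε := 1) (by simp) (by simpa),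
    hside (ε := -1) (by simp) (by simpa)]
  ring

lemma eventually_vertical_chord (c : ℝ) : ∀ᶠ r : ℝ in atTop,
    ∀ z ∈ segment ℝ ((c : ℂ) + r * angleDir 1) ((c : ℂ) + r * angleDir (-1)),
      ‖z‖ ≤ 2 * c - 3 * z.re ∧ r ≤ 4 * ‖z‖ := by
  filter_upwards [eventually_ge_atTop 0, eventually_ge_atTop (2 * |c|)] with r hr hrc z hz
  have hre : z.re = c - r := by
    obtain ⟨s, t, -, -, hst, rfl⟩ := hz
    rw [add_re, smul_re, smul_re, re_add_mul_angleDir, re_add_mul_angleDir, ← add_smul, hst,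
      one_smul]
  have him : |z.im| ≤ 2 * r := by
    obtain ⟨s, t, hs, ht, hst, rfl⟩ := hz
    rw [add_im, smul_im, smul_im, im_add_mul_angleDir, im_add_mul_angleDir, abs_le]
    simp only [smul_eq_mul]
    constructor <;> nlinarith
  have hc_le := le_abs_self c
  have hnorm := norm_le_abs_re_add_abs_im z
  have hre_norm := abs_re_le_norm z
  rw [abs_of_nonpos (by linarith : z.re ≤ 0)] at hnorm hre_norm
  exact ⟨by linarith, by linarith⟩

theorem angleIntegral_mul_exp_eq_zero {g : ℂ → ℂ} (hd : Differentiable ℂ g) {m : ℕ}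
    (hg : g =O[cobounded ℂ] fun z => z ^ m) {κ : ℝ} (hκ : 0 < κ) (c : ℝ) :
    angleIntegral c (fun z => g z * exp (κ * z)) = 0 := by
  have hd_exp : Differentiable ℂ fun z => g z * exp (κ * z) := hd.mul (by fun_prop)
  obtain ⟨F, hF⟩ := hd_exp.isExactOn_univ
  have hdecay := mul_exp_isBigO_inv_sq inf_le_left
    (hg.mono (inf_le_left (b := 𝓟 {z | ‖z‖ ≤ 2 * c - 3 * z.re})))
    (by positivity : 0 < κ / 3) (mem_inf_of_right fun z hz => hz)
  rw [angleIntegral, rayIntegral_sub_rayIntegral isOpen_univ hF hdecay (angleDir_ne_zero 1)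
    (angleDir_ne_zero (-1)) (fun _ _ => mem_univ _) (fun _ _ => mem_univ _)
    ((eventually_vertical_chord c).mono fun r hr z hz => ⟨mem_univ z, hr z hz⟩), sub_self]

/-! ### Cauchy's formula on the angle -/

/-- Integrability of `f` along both sides of the angle with vertex `c`. -/
def AngleIntegrable (c : ℝ) (f : ℂ → ℂ) : Prop :=
  ∀ ε : ℝ, |ε| = 1 → IntegrableOn (fun r : ℝ => f (c + r * angleDir ε)) (Ioi 0)

lemma abs_im_add_mul_angleDir (c : ℝ) {ε r : ℝ} (hε : |ε| = 1) (hr : 0 ≤ r) :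
    |((c : ℂ) + r * angleDir ε).im| = 2 * r := by
  rw [im_add_mul_angleDir, abs_mul, abs_mul, hε, abs_two, mul_one, abs_of_nonneg hr]

lemma eventually_angle_mem_sector (c : ℝ) {ε : ℝ} (hε : |ε| = 1) :
    ∀ᶠ r : ℝ in atTop, (c : ℂ) + r * angleDir ε ∈ sector := by
  filter_upwards [eventually_ge_atTop 0, eventually_ge_atTop (-c)] with r hr hrc
  change -|((c : ℂ) + r * angleDir ε).im| ≤ ((c : ℂ) + r * angleDir ε).re
  rw [re_add_mul_angleDir, abs_im_add_mul_angleDir c hε hr]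
  linarith

lemma tendsto_angle_atSector (c : ℝ) {ε : ℝ} (hε : |ε| = 1) :
    Tendsto (fun r : ℝ => (c : ℂ) + r * angleDir ε) atTop atSector :=
  tendsto_inf.2 ⟨tendsto_ray c (angleDir_ne_zero ε),
    tendsto_principal.2 (eventually_angle_mem_sector c hε)⟩

lemma continuousOn_comp_angle {γ c : ℝ} (hc : γ < c) {f : ℂ → ℂ}
    (hf : ContinuousOn f (slit γ ∩ {z | z.re ≤ c})) {ε : ℝ} (hε : |ε| = 1) :
    ContinuousOn (fun r : ℝ => f (c + r * angleDir ε)) (Ici 0) :=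
  hf.comp (by fun_prop) fun r (hr : 0 ≤ r) =>
    ⟨add_mul_angleDir_mem_slit hc (abs_ne_zero.1 (hε ▸ one_ne_zero)) hr,
      (re_add_mul_angleDir c ε r).trans_le (by linarith)⟩

lemma angleIntegrable_of_isBigO {γ c : ℝ} (hc : γ < c) {f : ℂ → ℂ}
    (hcont : ContinuousOn f (slit γ ∩ {z | z.re ≤ c})) {T : Set ℂ}
    (hf : f =O[cobounded ℂ ⊓ 𝓟 T] fun z => (z ^ 2)⁻¹)
    (hT : ∀ ε : ℝ, |ε| = 1 → ∀ᶠ r : ℝ in atTop, c + r * angleDir ε ∈ T) : AngleIntegrable c f :=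
  fun ε hε => integrableOn_ray (angleDir_ne_zero ε)
    (continuousOn_comp_angle hc hcont hε) hf (hT ε hε)

lemma angleIntegrable_mul_exp {γ c : ℝ} (hc : γ < c) {g : ℂ → ℂ}
    (hd : DifferentiableOn ℂ g (slit γ)) {m : ℕ} (hg : g =O[atSector] fun z => z ^ m) {κ : ℝ}
    (hκ : 0 < κ) : AngleIntegrable c fun z => g z * exp (κ * z) := by
  have hdecay := mul_exp_isBigO_inv_sq inf_le_left (hg.mono (inf_le_inf_left _
    (principal_mono.2 (inter_subset_left (t := {z | ‖z‖ ≤ |c| + 3 * c - 3 * z.re})))))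
    (by positivity : 0 < κ / 3) (mem_inf_of_right fun z hz => hz.2)
  have hcont : ContinuousOn (fun z => g z * exp (κ * z)) (slit γ) :=
    hd.continuousOn.mul (by fun_prop)
  refine angleIntegrable_of_isBigO hc (hcont.mono inter_subset_left) hdecay fun ε hε => ?_
  filter_upwards [eventually_angle_mem_sector c hε, eventually_ge_atTop 0] with r hr hr0
  refine ⟨hr, (norm_le_abs_re_add_abs_im _).trans ?_⟩
  rw [re_add_mul_angleDir, abs_im_add_mul_angleDir c hε hr0]
  have htri := abs_sub c r
  rw [abs_of_nonneg hr0] at htri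
  linarith

lemma angleIntegral_congr {c : ℝ} {f g : ℂ → ℂ} (hfg : ∀ z : ℂ, z.re ≤ c → f z = g z) :
    angleIntegral c f = angleIntegral c g := by
  have hray (ε : ℝ) : rayIntegral f c (angleDir ε) = rayIntegral g c (angleDir ε) := by
    rw [rayIntegral, rayIntegral, setIntegral_congr_fun measurableSet_Ioi fun r (hr : 0 < r) =>
      hfg _ ((re_add_mul_angleDir c ε r).trans_le (by linarith))]
  rw [angleIntegral, angleIntegral, hray, hray]

lemma angleIntegral_const_mul (c : ℝ) (w : ℂ) (f : ℂ → ℂ) :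
    angleIntegral c (fun z => w * f z) = w * angleIntegral c f := by
  simp only [angleIntegral, rayIntegral, integral_const_mul]
  ring

lemma angleIntegral_add {c : ℝ} {f g : ℂ → ℂ} (hf : AngleIntegrable c f)
    (hg : AngleIntegrable c g) :
    angleIntegral c (fun z => f z + g z) = angleIntegral c f + angleIntegral c g := by
  have hray {ε : ℝ} (hε : |ε| = 1) : rayIntegral (fun z => f z + g z) c (angleDir ε) =
      rayIntegral f c (angleDir ε) + rayIntegral g c (angleDir ε) := by
    rw [rayIntegral, integral_add (hf ε hε) (hg ε hε), add_mul, rayIntegral, rayIntegral]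
  rw [angleIntegral, hray (by simp), hray (by simp), angleIntegral, angleIntegral]
  ring

lemma eventually_right_angle_chord (c : ℝ) {ε : ℝ} (hε : |ε| = 1) : ∀ᶠ r : ℝ in atTop,
    ∀ z ∈ segment ℝ ((c : ℂ) + r * angleDir ε) ((c : ℂ) + r * 1),
      z.re + |z.im| = c + r ∧ z ∈ sector ∧ r ≤ 4 * ‖z‖ := by
  filter_upwards [eventually_ge_atTop 0, eventually_ge_atTop (2 * |c|)] with r hr hrc z hz
  have hsum : z.re + |z.im| = c + r := by
    obtain ⟨s, t, hs, -, hst, rfl⟩ := hz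
    have him : |(s • ((c : ℂ) + r * angleDir ε) + t • ((c : ℂ) + r * 1)).im| = s * (2 * r) := by
      rw [← abs_im_add_mul_angleDir c hε hr, ← abs_of_nonneg hs, ← abs_mul, abs_of_nonneg hs]
      simp
    have hre : (s • ((c : ℂ) + r * angleDir ε) + t • ((c : ℂ) + r * 1)).re =
        s * (c - r) + t * (c + r) := by
      rw [add_re, smul_re, smul_re, re_add_mul_angleDir]
      simp
    rw [hre, him]
    linear_combination (c + r) * hst
  have hc_le := neg_abs_le c
  refine ⟨hsum, ?_, by linarith [re_le_norm z, abs_im_le_norm z]⟩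
  change -|z.im| ≤ z.re
  linarith [abs_nonneg c]

lemma angleIntegral_eq_zero {γ c : ℝ} (hc : γ < c) {f : ℂ → ℂ}
    (hd : DifferentiableOn ℂ f (slit γ)) (hf : f =O[atSector] fun z => (z ^ 2)⁻¹) :
    angleIntegral c f = 0 := by
  obtain ⟨F, hF⟩ := isExactOn_slit hd
  have hray {ε : ℝ} (hε : |ε| = 1) : rayIntegral f c (angleDir ε) = rayIntegral f c 1 := by
    have hne : ε ≠ 0 := abs_ne_zero.1 (hε ▸ one_ne_zero)
    have hright : ∀ r : ℝ, 0 ≤ r → (c : ℂ) + r * 1 ∈ slit γ := fun r hr =>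
      mem_slit.2 (.inl (by simp; linarith))
    linear_combination rayIntegral_sub_rayIntegral (isOpen_slit γ) hF hf (angleDir_ne_zero ε)
      one_ne_zero (fun r hr => add_mul_angleDir_mem_slit hc hne hr) hright (by
        filter_upwards [eventually_right_angle_chord c hε, eventually_ge_atTop 0] with r hr hr0 z hz
        obtain ⟨hsum, hsector, hle⟩ := hr z hz
        refine ⟨mem_slit.2 (or_iff_not_imp_right.2 fun him => ?_), hsector, hle⟩
        rw [not_not.1 him, abs_zero] at hsum
        linarith)
  rw [angleIntegral, hray (by simp), hray (by simp), sub_self]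

lemma tendsto_log_add_mul_sub_log (w : ℂ) {ω : ℂ} (hω : ω ∈ slitPlane) :
    Tendsto (fun r : ℝ => log (w + r * ω) - Real.log r) atTop (𝓝 (log ω)) := by
  have hinv : Tendsto (fun r : ℝ => w * (r : ℂ)⁻¹ + ω) atTop (𝓝 ω) := by
    simpa using ((tendsto_inv₀_cobounded.comp
      (RCLike.tendsto_ofReal_atTop_cobounded ℂ)).const_mul w).add_const ω
  refine ((continuousAt_clog hω).tendsto.comp hinv).congr' ?_
  filter_upwards [eventually_gt_atTop 0, hinv.eventually_ne (slitPlane_ne_zero hω)] with r hr hne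
  have hr' : (r : ℂ) ≠ 0 := ofReal_ne_zero.2 hr.ne'
  rw [Function.comp_apply, eq_sub_iff_add_eq', ← log_ofReal_mul hr hne]
  field_simp

lemma log_sub_log_neg_of_im_pos {z : ℂ} (hz : 0 < z.im) : log z - log (-z) = Real.pi * I := by
  rw [log, log, norm_neg, arg_neg_eq_arg_sub_pi_of_im_pos hz]
  push_cast
  ring

lemma log_angleDir_sub_log_neg {ε : ℝ} (hε : |ε| = 1) :
    log (angleDir ε) - log (-angleDir ε) = ε * (Real.pi * I) := by
  rcases (abs_eq zero_le_one).1 hε with rfl | rfl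
  · simpa using log_sub_log_neg_of_im_pos (z := angleDir 1) (by simp [angleDir])
  · have h := log_sub_log_neg_of_im_pos (z := -angleDir (-1)) (by simp [angleDir])
    rw [neg_neg] at h
    push_cast
    linear_combination -h

lemma inv_sub_isBigO (w : ℂ) : (fun z => (z - w)⁻¹) =O[cobounded ℂ] fun z => z⁻¹ := by
  have hid : (fun z : ℂ => z) =O[cobounded ℂ] fun z => z - w :=
    (isLittleO_const_id_cobounded w).right_isBigO_sub
  refine hid.inv_rev ?_
  filter_upwards [eventually_ne_cobounded 0] with z hz h using absurd h hz

lemma inv_mul_inv_isBigO (γ s : ℂ) :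
    (fun z => (z - γ)⁻¹ * (s - z)⁻¹) =O[cobounded ℂ] fun z => (z ^ 2)⁻¹ := by
  refine ((inv_sub_isBigO γ).mul (inv_sub_isBigO s).neg_left).congr (fun z => ?_) fun z => ?_
  · rw [← inv_neg, neg_sub]
  · rw [← mul_inv, sq]

lemma angleIntegrable_inv_mul_inv {γ c : ℝ} (hc : γ < c) {s : ℂ} (hs : c < s.re) :
    AngleIntegrable c fun z => (z - γ)⁻¹ * (s - z)⁻¹ := by
  refine angleIntegrable_of_isBigO hc ?_
    ((inv_mul_inv_isBigO γ s).mono (inf_le_left (b := 𝓟 univ))) fun _ _ => .of_forall mem_univ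
  refine ContinuousOn.mul (.inv₀ (by fun_prop) fun z hz => slitPlane_ne_zero hz.1)
    (.inv₀ (by fun_prop) fun z hz h => ?_)
  rw [← sub_eq_zero.1 h] at hz
  exact hs.not_ge hz.2

lemma hasDerivAt_log_sub_sub_log_sub {w s z : ℂ} (hw : z - w ∈ slitPlane)
    (hs : s - z ∈ slitPlane) (hne : s ≠ w) :
    HasDerivAt (fun z => (s - w)⁻¹ * (log (z - w) - log (s - z))) ((z - w)⁻¹ * (s - z)⁻¹) z := by
  refine ((((hasDerivAt_id z).sub_const w).clog hw).sub
    (((hasDerivAt_id z).const_sub s).clog hs) |>.const_mul _).congr_deriv ?_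
  have hw' := slitPlane_ne_zero hw
  have hs' := slitPlane_ne_zero hs
  have hne' := sub_ne_zero.2 hne
  rw [id]
  field_simp
  ring

lemma rayIntegral_inv_mul_inv {γ c : ℝ} (hc : γ < c) {s : ℂ} (hs : c < s.re) {ε : ℝ}
    (hε : |ε| = 1) :
    rayIntegral (fun z => (z - γ)⁻¹ * (s - z)⁻¹) c (angleDir ε) =
      (s - γ)⁻¹ * (ε * (Real.pi * I) - (log (c - γ) - log (s - c))) := by
  have hne : ε ≠ 0 := abs_ne_zero.1 (hε ▸ one_ne_zero)
  set Ψ : ℂ → ℂ := fun z => (s - γ)⁻¹ * (log (z - γ) - log (s - z))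
  have hΨ : ∀ r : ℝ, 0 ≤ r → HasDerivAt Ψ ((c + r * angleDir ε - γ)⁻¹ *
      (s - (c + r * angleDir ε))⁻¹) (c + r * angleDir ε) := by
    intro r hr
    refine hasDerivAt_log_sub_sub_log_sub (add_mul_angleDir_mem_slit hc hne hr)
      (mem_slitPlane_iff.2 (.inl ?_)) fun h => ?_
    · rw [sub_re, re_add_mul_angleDir]
      linarith
    · rw [h, ofReal_re] at hs
      linarith
  have hlim := (((tendsto_log_add_mul_sub_log (c - γ) (ω := angleDir ε)
    (mem_slitPlane_iff.2 (.inr (by simp [angleDir, hne])))).sub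
    (tendsto_log_add_mul_sub_log (s - c) (ω := -angleDir ε)
    (mem_slitPlane_iff.2 (.inl (by simp [angleDir])))))).const_mul (s - γ)⁻¹
  rw [log_angleDir_sub_log_neg hε] at hlim
  have hΨ_lim : Tendsto (fun r : ℝ => Ψ (c + r * angleDir ε)) atTop
      (𝓝 ((s - γ)⁻¹ * (ε * (Real.pi * I)))) := by
    refine hlim.congr fun r => ?_
    simp only [Ψ]
    ring_nf
  linear_combination tendsto_nhds_unique
    (tendsto_primitive_ray (f := fun z => (z - γ)⁻¹ * (s - z)⁻¹) hΨ
      (angleIntegrable_inv_mul_inv hc hs ε hε)) hΨ_lim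

lemma angleIntegral_inv_mul_inv {γ c : ℝ} (hc : γ < c) {s : ℂ} (hs : c < s.re) :
    angleIntegral c (fun z => (z - γ)⁻¹ * (s - z)⁻¹) = 2 * Real.pi * I * (s - γ)⁻¹ := by
  rw [angleIntegral, rayIntegral_inv_mul_inv hc hs (by simp),
    rayIntegral_inv_mul_inv hc hs (by simp)]
  push_cast
  ring

lemma dslope_isBigO {K : ℂ → ℂ} (hK : K =O[atSector] fun z => z⁻¹) {s : ℂ} (hs : K s = 0) :
    dslope K s =O[atSector] fun z => (z ^ 2)⁻¹ := by
  refine (((inv_sub_isBigO s).mono inf_le_left).mul hK).congr' ?_ (.of_forall fun z => ?_)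
  · filter_upwards [eventually_ne_atSector s] with z hz
    rw [dslope_of_ne K hz, slope_def_module, hs, sub_zero, smul_eq_mul]
  · simp only [sq, mul_inv]

/- Subtracting a multiple of `(z - γ)⁻¹` makes `K` vanish at `s`, and then the quotient has no pole
at `s` and decays quadratically. -/
theorem angleIntegral_div_sub_eq {γ c : ℝ} (hc : γ < c) {K : ℂ → ℂ}
    (hd : DifferentiableOn ℂ K (slit γ)) (hK : K =O[atSector] fun z => z⁻¹) {s : ℂ}
    (hs : c < s.re) :
    angleIntegral c (fun z => K z / (s - z)) = 2 * Real.pi * I * K s := by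
  have hs_slit : s ∈ slit γ := mem_slit.2 (.inl (hc.trans hs))
  have hsγ : s - γ ≠ 0 := slitPlane_ne_zero hs_slit
  set K₀ : ℂ → ℂ := fun z => K z - K s * (s - γ) * (z - γ)⁻¹
  have hK₀_zero : K₀ s = 0 := by simp only [K₀]; field_simp; ring
  have hinv : DifferentiableOn ℂ (fun z : ℂ => (z - γ)⁻¹) (slit γ) :=
    .inv (by fun_prop) fun z hz => slitPlane_ne_zero hz
  have hd₀ : DifferentiableOn ℂ K₀ (slit γ) := hd.sub (hinv.const_mul _)
  have hd_slope : DifferentiableOn ℂ (dslope K₀ s) (slit γ) :=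
    (differentiableOn_dslope ((isOpen_slit γ).mem_nhds hs_slit)).2 hd₀
  have hO_slope : dslope K₀ s =O[atSector] fun z => (z ^ 2)⁻¹ := dslope_isBigO
    (hK.sub (((inv_sub_isBigO γ).mono inf_le_left).const_mul_left _)) hK₀_zero
  have hsplit : ∀ z : ℂ, z.re ≤ c → K z / (s - z) =
      -1 * dslope K₀ s z + K s * (s - γ) * ((z - γ)⁻¹ * (s - z)⁻¹) := by
    intro z hz
    have hne : z ≠ s := fun h => hs.not_ge (h ▸ hz)
    rw [dslope_of_ne K₀ hne, slope_def_field, hK₀_zero, ← neg_sub z s, inv_neg, div_neg]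
    simp only [K₀]
    ring
  rw [angleIntegral_congr hsplit, angleIntegral_add, angleIntegral_const_mul,
    angleIntegral_const_mul, angleIntegral_eq_zero hc hd_slope hO_slope,
    angleIntegral_inv_mul_inv hc hs]
  · field_simp
    ring
  · exact fun ε hε => (angleIntegrable_of_isBigO hc (hd_slope.continuousOn.mono inter_subset_left)
      hO_slope (fun _ => eventually_angle_mem_sector c) ε hε).const_mul _
  · exact fun ε hε => (angleIntegrable_inv_mul_inv hc hs ε hε).const_mul _

/-! ### The Mellin transform -/

lemma exp_log_div_mul {ρ x : ℝ} (hρ : 0 < ρ) (hx : 0 < x) (z : ℂ) :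
    exp (Real.log (ρ / x) * z) = (ρ : ℂ) ^ z * (x : ℂ) ^ (-z) := by
  rw [cpow_def_of_ne_zero (ofReal_ne_zero.2 hρ.ne'), cpow_def_of_ne_zero (ofReal_ne_zero.2 hx.ne'),
    ← exp_add, ← ofReal_log hρ.le, ← ofReal_log hx.le, Real.log_div hρ.ne' hx.ne']
  push_cast
  ring_nf

lemma exp_log_div_mul_cpow {ρ x : ℝ} (hρ : 0 < ρ) (hx : 0 < x) (z s : ℂ) :
    exp (Real.log (ρ / x) * z) * (x : ℂ) ^ (s - 1) = (ρ : ℂ) ^ z * (x : ℂ) ^ (s - z - 1) := by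
  rw [exp_log_div_mul hρ hx, mul_assoc, ← cpow_add _ _ (ofReal_ne_zero.2 hx.ne')]
  ring_nf

lemma integrableOn_exp_log_div_mul_cpow {ρ : ℝ} (hρ : 0 < ρ) {z s : ℂ} (hz : z.re < s.re) :
    IntegrableOn (fun x : ℝ => exp (Real.log (ρ / x) * z) * (x : ℂ) ^ (s - 1)) (Ioc 0 ρ) := by
  have hpow : IntervalIntegrable (fun x : ℝ => (x : ℂ) ^ (s - z - 1)) volume 0 ρ :=
    intervalIntegral.intervalIntegrable_cpow' (by simp; linarith)
  rw [intervalIntegrable_iff_integrableOn_Ioc_of_le hρ.le] at hpow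
  exact IntegrableOn.congr_fun (hpow.const_mul ((ρ : ℂ) ^ z))
    (fun x hx => (exp_log_div_mul_cpow hρ hx.1 z s).symm) measurableSet_Ioc

lemma integral_exp_log_div_mul_cpow {ρ : ℝ} (hρ : 0 < ρ) {z s : ℂ} (hz : z.re < s.re) :
    ∫ x : ℝ in Ioc 0 ρ, exp (Real.log (ρ / x) * z) * (x : ℂ) ^ (s - 1) =
      (ρ : ℂ) ^ s / (s - z) := by
  have hne : s - z ≠ 0 := sub_ne_zero.2 fun h => hz.ne' (congrArg re h)
  rw [setIntegral_congr_fun measurableSet_Ioc fun x hx => exp_log_div_mul_cpow hρ hx.1 z s,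
    integral_const_mul, ← intervalIntegral.integral_of_le hρ.le,
    integral_cpow (.inl (by simp; linarith)), sub_add_cancel, ofReal_zero, zero_cpow hne, sub_zero,
    mul_div_assoc', ← cpow_add _ _ (ofReal_ne_zero.2 hρ.ne'), add_sub_cancel]

lemma norm_exp_log_div_mul_cpow {ρ x : ℝ} (hx : 0 < x) (z s : ℂ) :
    ((‖exp (Real.log (ρ / x) * z) * (x : ℂ) ^ (s - 1)‖ : ℝ) : ℂ) =
      exp (Real.log (ρ / x) * z.re) * (x : ℂ) ^ ((s.re : ℂ) - 1) := by
  rw [norm_mul, norm_exp, re_ofReal_mul, norm_cpow_eq_rpow_re_of_pos hx]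
  push_cast
  rw [ofReal_cpow hx.le]
  simp

lemma integral_norm_exp_log_div_mul_cpow {ρ : ℝ} (hρ : 0 < ρ) {z s : ℂ} (hz : z.re < s.re) :
    ∫ x : ℝ in Ioc 0 ρ, ‖exp (Real.log (ρ / x) * z) * (x : ℂ) ^ (s - 1)‖ =
      ρ ^ s.re / (s.re - z.re) := by
  apply ofReal_injective
  rw [← integral_complex_ofReal, setIntegral_congr_fun measurableSet_Ioc fun x hx =>
    norm_exp_log_div_mul_cpow hx.1 z s, integral_exp_log_div_mul_cpow hρ (by simpa)]
  push_cast
  rw [ofReal_cpow hρ.le]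

section Superposition

variable {α : Type*} [MeasurableSpace α] {μ : Measure α} [SFinite μ] {k z : α → ℂ} {ρ : ℝ} {s : ℂ}

lemma integrable_prod_exp_log_div_mul_cpow (hρ : 0 < ρ) (hk : AEStronglyMeasurable k μ)
    (hz : AEMeasurable z μ) (hre : ∀ᵐ r ∂μ, (z r).re < s.re)
    (hint : Integrable (fun r => ‖k r‖ / (s.re - (z r).re)) μ) :
    Integrable (fun y : ℝ × α => k y.2 * (exp (Real.log (ρ / y.1) * z y.2) * (y.1 : ℂ) ^ (s - 1)))
      ((volume.restrict (Ioc 0 ρ)).prod μ) := by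
  have hmeas : AEStronglyMeasurable
      (fun y : ℝ × α => k y.2 * (exp (Real.log (ρ / y.1) * z y.2) * (y.1 : ℂ) ^ (s - 1)))
      ((volume.restrict (Ioc 0 ρ)).prod μ) := by
    have : AEMeasurable (fun y : ℝ × α => z y.2) ((volume.restrict (Ioc 0 ρ)).prod μ) :=
      hz.comp_snd
    exact hk.comp_snd.mul (AEMeasurable.aestronglyMeasurable (by fun_prop))
  refine (integrable_prod_iff' hmeas).2 ⟨?_, (hint.const_mul (ρ ^ s.re)).congr ?_⟩
  · filter_upwards [hre] with r hr using (integrableOn_exp_log_div_mul_cpow hρ hr).const_mul _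
  · filter_upwards [hre] with r hr
    simp only [norm_mul (k r), integral_const_mul, integral_norm_exp_log_div_mul_cpow hρ hr]
    ring

lemma integrableOn_integral_mul_exp_mul_cpow (hρ : 0 < ρ) (hk : AEStronglyMeasurable k μ)
    (hz : AEMeasurable z μ) (hre : ∀ᵐ r ∂μ, (z r).re < s.re)
    (hint : Integrable (fun r => ‖k r‖ / (s.re - (z r).re)) μ) :
    IntegrableOn (fun x : ℝ => (∫ r, k r * exp (Real.log (ρ / x) * z r) ∂μ) * (x : ℂ) ^ (s - 1))
      (Ioc 0 ρ) := by
  refine (integrable_prod_exp_log_div_mul_cpow hρ hk hz hre hint).integral_prod_left.congr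
    (.of_forall fun x => ?_)
  simp only [← mul_assoc, integral_mul_const]

lemma integral_integral_mul_exp_mul_cpow (hρ : 0 < ρ) (hk : AEStronglyMeasurable k μ)
    (hz : AEMeasurable z μ) (hre : ∀ᵐ r ∂μ, (z r).re < s.re)
    (hint : Integrable (fun r => ‖k r‖ / (s.re - (z r).re)) μ) :
    ∫ x : ℝ in Ioc 0 ρ, (∫ r, k r * exp (Real.log (ρ / x) * z r) ∂μ) * (x : ℂ) ^ (s - 1) =
      (ρ : ℂ) ^ s * ∫ r, k r / (s - z r) ∂μ := by
  simp only [← integral_mul_const, mul_assoc]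
  rw [integral_integral_swap (integrable_prod_exp_log_div_mul_cpow hρ hk hz hre hint),
    ← integral_const_mul]
  refine integral_congr_ae ?_
  filter_upwards [hre] with r hr
  rw [integral_const_mul, integral_exp_log_div_mul_cpow hρ hr]
  ring

end Superposition

lemma integrableOn_norm_div_angle {γ c : ℝ} (hc : γ < c) {K : ℂ → ℂ}
    (hd : DifferentiableOn ℂ K (slit γ)) (hK : K =O[atSector] fun z => z⁻¹) {σ : ℝ} (hσ : c < σ)
    {ε : ℝ} (hε : |ε| = 1) :
    IntegrableOn (fun r : ℝ => ‖K (c + r * angleDir ε)‖ / (σ - ((c : ℂ) + r * angleDir ε).re))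
      (Ioi 0) := by
  simp only [re_add_mul_angleDir]
  have hcont : ContinuousOn (fun r : ℝ => ‖K (c + r * angleDir ε)‖ / (σ - (c - r))) (Ici 0) :=
    (continuousOn_comp_angle hc (hd.continuousOn.mono inter_subset_left) hε).norm.div
      (by fun_prop) fun r (hr : 0 ≤ r) => by linarith
  have hK_ray : (fun r : ℝ => ‖K (c + r * angleDir ε)‖) =O[atTop] fun r => r⁻¹ :=
    ((hK.comp_tendsto (tendsto_angle_atSector c hε)).trans
      (ray_inv_isBigO c (angleDir_ne_zero ε))).norm_left
  have hweight : (fun r : ℝ => (σ - (c - r))⁻¹) =O[atTop] fun r => r⁻¹ := by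
    refine IsBigO.of_bound 1 ?_
    filter_upwards [eventually_gt_atTop 0] with r hr
    rw [one_mul, norm_inv, norm_inv, Real.norm_of_nonneg hr.le,
      Real.norm_of_nonneg (by linarith : 0 ≤ σ - (c - r))]
    gcongr
    linarith
  refine IntegrableOn.mono_set ?_ Ioi_subset_Ici_self
  refine (hcont.locallyIntegrableOn measurableSet_Ici).integrableOn_of_isBigO_atTop
    (g := fun r => r ^ (-2 : ℝ)) ((hK_ray.mul hweight).congr' (.of_forall fun r => rfl) ?_)
    (integrableAtFilter_rpow_atTop_iff.2 (by norm_num))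
  filter_upwards [eventually_ge_atTop 0] with r hr
  rw [Real.rpow_neg hr, Real.rpow_ofNat, sq, mul_inv]

theorem integral_angleIntegral_mul_cpow {γ c : ℝ} (hc : γ < c) {K : ℂ → ℂ}
    (hd : DifferentiableOn ℂ K (slit γ)) (hK : K =O[atSector] fun z => z⁻¹) {s : ℂ}
    (hs : c < s.re) {ρ : ℝ} (hρ : 0 < ρ) :
    IntegrableOn (fun x : ℝ => angleIntegral c (fun z => K z * exp (Real.log (ρ / x) * z)) *
      (x : ℂ) ^ (s - 1)) (Ioc 0 ρ) ∧
    ∫ x : ℝ in Ioc 0 ρ, angleIntegral c (fun z => K z * exp (Real.log (ρ / x) * z)) *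
      (x : ℂ) ^ (s - 1) = (ρ : ℂ) ^ s * angleIntegral c fun z => K z / (s - z) := by
  have hmeas {ε : ℝ} (hε : |ε| = 1) : AEStronglyMeasurable
      (fun r : ℝ => K (c + r * angleDir ε)) (volume.restrict (Ioi 0)) :=
    ((continuousOn_comp_angle hc (hd.continuousOn.mono inter_subset_left) hε).mono
      Ioi_subset_Ici_self).aestronglyMeasurable measurableSet_Ioi
  have hre (ε : ℝ) : ∀ᵐ r : ℝ ∂volume.restrict (Ioi 0),
      ((c : ℂ) + r * angleDir ε).re < s.re := by
    filter_upwards [self_mem_ae_restrict measurableSet_Ioi] with r (hr : 0 < r)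
    rw [re_add_mul_angleDir]
    linarith
  have hintegrable {ε : ℝ} (hε : |ε| = 1) := integrableOn_integral_mul_exp_mul_cpow hρ
    (hmeas hε) (by fun_prop) (hre ε) (integrableOn_norm_div_angle hc hd hK hs hε)
  have hintegral {ε : ℝ} (hε : |ε| = 1) := integral_integral_mul_exp_mul_cpow hρ
    (hmeas hε) (by fun_prop) (hre ε) (integrableOn_norm_div_angle hc hd hK hs hε)
  have h₁ : |(1 : ℝ)| = 1 := abs_one
  have h₂ : |(-1 : ℝ)| = 1 := by simp
  simp only [angleIntegral, rayIntegral, sub_mul, mul_right_comm _ (angleDir _)]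
  have hside₁ := (hintegrable h₁).mul_const (angleDir 1)
  have hside₂ := (hintegrable h₂).mul_const (angleDir (-1))
  refine ⟨hside₁.sub hside₂, ?_⟩
  rw [integral_sub hside₁ hside₂, integral_mul_const, integral_mul_const, hintegral h₁,
    hintegral h₂]
  ring

lemma gammaRatio_mul_cpow_neg {A : Fin p → ℝ} {B : Fin q → ℝ} (hA : ∀ k, 0 < A k)
    (hB : ∀ j, 0 < B j) (a : Fin p → ℝ) (b : Fin q → ℝ) {x : ℝ} (hx : 0 < x) (z : ℂ) :
    gammaRatio A a B b z * (x : ℂ) ^ (-z) =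
      gammaRatio A a B b z * (rho A B : ℂ) ^ (-z) * exp (Real.log (rho A B / x) * z) := by
  have hρ := rho_pos hA hB
  rw [exp_log_div_mul hρ hx, mul_assoc, ← mul_assoc _ _ ((x : ℂ) ^ (-z)),
    ← cpow_add _ _ (ofReal_ne_zero.2 hρ.ne'), neg_add_cancel, cpow_zero, one_mul]

section

variable {A a : Fin p → ℝ} {B b : Fin q → ℝ} {m : ℕ} {c φ₁ φ₂ x : ℝ} {s : ℂ}

theorem H_eq_zero (hA : ∀ k, 0 < A k) (hB : ∀ j, 0 < B j) (hΔ : Delta A B = 0)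
    (hμ : mu a b = -(m : ℝ)) (hc : gam A a < c) (φ₁ φ₂ : ℝ) (hx : rho A B < x) :
    H A a B b c φ₁ φ₂ x = 0 := by
  have hx0 : 0 < x := (rho_pos hA hB).trans hx
  have hκ : Real.log (rho A B / x) < 0 :=
    Real.log_neg (div_pos (rho_pos hA hB) hx0) ((div_lt_one hx0).2 hx)
  simp only [H, if_neg hx.not_gt, gammaRatio_mul_cpow_neg hA hB a b hx0]
  rw [rightLoopIntegral_mul_exp_eq_zero hc
    (differentiableOn_gammaRatio_mul_rho_cpow_neg b hA hB)
    (gammaRatio_mul_rho_cpow_neg_isBigO_atSector hA hB hΔ hμ) hκ, mul_zero]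

theorem H_eq_angleIntegral (hA : ∀ k, 0 < A k) (hB : ∀ j, 0 < B j) (hΔ : Delta A B = 0)
    (hμ : mu a b = -(m : ℝ)) (hc : gam A a < c) (hφ₁ : φ₁ < 0) (hφ₂ : 0 < φ₂) {c' : ℝ}
    (hc' : gam A a < c') (hx : x ∈ Ioo 0 (rho A B)) :
    H A a B b c φ₁ φ₂ x = 1 / (2 * Real.pi * I) *
      angleIntegral c' fun z => remainder A a B b m z * exp (Real.log (rho A B / x) * z) := by
  have hκ : 0 < Real.log (rho A B / x) := Real.log_pos ((one_lt_div hx.1).2 hx.2)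
  have hP := principalPart_isBigO A a B b m
  have hP_diff := differentiable_principalPart A a B b m
  have hG := gammaRatio_mul_rho_cpow_neg_isBigO_atSector hA hB hΔ hμ
  simp only [H, if_pos hx.2, gammaRatio_mul_cpow_neg hA hB a b hx.1]
  rw [leftLoopIntegral_mul_exp_eq_angleIntegral hc hc' hφ₁ hφ₂
    (differentiableOn_gammaRatio_mul_rho_cpow_neg b hA hB)
    (fun _ => gammaRatio_mul_rho_cpow_neg_isBigO_leftRegion hA hB hΔ hμ 0) hκ]
  congr 1
  calc angleIntegral c' (fun z => gammaRatio A a B b z * (rho A B : ℂ) ^ (-z) *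
        exp (Real.log (rho A B / x) * z))
      = angleIntegral c' fun z => remainder A a B b m z * exp (Real.log (rho A B / x) * z) +
          principalPart A a B b m z * exp (Real.log (rho A B / x) * z) := by
        simp only [remainder, ← add_mul, sub_add_cancel]
    _ = angleIntegral c' (fun z => remainder A a B b m z * exp (Real.log (rho A B / x) * z)) := by
        rw [angleIntegral_add (angleIntegrable_mul_exp hc' (differentiableOn_remainder b hA hB m)
          (hG.sub (hP.mono inf_le_left)) hκ) (angleIntegrable_mul_exp hc' hP_diff.differentiableOn
          (hP.mono inf_le_left) hκ), angleIntegral_mul_exp_eq_zero hP_diff hP hκ, add_zero]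

theorem integral_H_mul_cpow (hA : ∀ k, 0 < A k) (hB : ∀ j, 0 < B j) (hΔ : Delta A B = 0)
    (hμ : mu a b = -(m : ℝ)) (hc : gam A a < c) (hφ₁ : φ₁ < 0) (hφ₂ : 0 < φ₂)
    (hs : gam A a < s.re) :
    IntegrableOn (fun x : ℝ => H A a B b c φ₁ φ₂ x * (x : ℂ) ^ (s - 1)) (Ioc 0 (rho A B)) ∧
    ∫ x in Ioc 0 (rho A B), H A a B b c φ₁ φ₂ x * (x : ℂ) ^ (s - 1) =
      (rho A B : ℂ) ^ s * remainder A a B b m s := by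
  obtain ⟨c', hc', hc's⟩ := exists_between hs
  have hd := differentiableOn_remainder (a := a) b hA hB m
  have hR := remainder_isBigO hA hB hΔ hμ
  obtain ⟨hint, hval⟩ := integral_angleIntegral_mul_cpow hc' hd hR hc's (rho_pos hA hB)
  have hH : (fun x : ℝ => 1 / (2 * Real.pi * I) * (angleIntegral c' (fun z =>
        remainder A a B b m z * exp (Real.log (rho A B / x) * z)) * (x : ℂ) ^ (s - 1)))
      =ᵐ[volume.restrict (Ioc 0 (rho A B))]
      fun x => H A a B b c φ₁ φ₂ x * (x : ℂ) ^ (s - 1) := by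
    rw [← Measure.restrict_congr_set (Ioo_ae_eq_Ioc (α := ℝ) (μ := volume))]
    filter_upwards [self_mem_ae_restrict measurableSet_Ioo] with x hx
    rw [H_eq_angleIntegral hA hB hΔ hμ hc hφ₁ hφ₂ hc' hx]
    ring
  refine ⟨(hint.const_mul _).congr hH, ?_⟩
  rw [← integral_congr_ae hH, integral_const_mul, hval, angleIntegral_div_sub_eq hc' hd hR hc's,
    mul_left_comm, one_div, inv_mul_cancel_left₀ two_pi_I_ne_zero]

lemma rho_cpow_mul_remainder (hA : ∀ k, 0 < A k) (hB : ∀ j, 0 < B j) (a : Fin p → ℝ)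
    (b : Fin q → ℝ) (m : ℕ) (s : ℂ) :
    (rho A B : ℂ) ^ s * remainder A a B b m s =
      gammaRatio A a B b s - (rho A B : ℂ) ^ s * principalPart A a B b m s := by
  have hcancel : (rho A B : ℂ) ^ s * (rho A B : ℂ) ^ (-s) = 1 := by
    rw [← cpow_add _ _ (ofReal_ne_zero.2 (rho_pos hA hB).ne'), add_neg_cancel, cpow_zero]
  rw [remainder]
  linear_combination gammaRatio A a B b s * hcancel

end

lemma mellinConvergent_of_forall_gt_eq_zero {f : ℝ → ℂ} {s : ℂ} {ρ : ℝ}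
    (hzero : ∀ x, ρ < x → f x = 0)
    (hint : IntegrableOn (fun x : ℝ => f x * (x : ℂ) ^ (s - 1)) (Ioc 0 ρ)) :
    MellinConvergent f s := by
  refine hint.of_forall_sdiff_eq_zero measurableSet_Ioi (fun x hx => ?_) |>.congr_fun
    (fun x _ => mul_comm _ _) measurableSet_Ioi
  rw [hzero x (not_le.1 fun h => hx.2 ⟨hx.1, h⟩), zero_mul]

lemma mellin_eq_intervalIntegral_of_forall_gt_eq_zero {f : ℝ → ℂ} {ρ : ℝ} (hρ : 0 ≤ ρ)
    (hzero : ∀ x, ρ < x → f x = 0) (s : ℂ) :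
    mellin f s = ∫ x in (0 : ℝ)..ρ, f x * (x : ℂ) ^ (s - 1) := by
  rw [intervalIntegral.integral_of_le hρ, mellin,
    ← setIntegral_eq_of_subset_of_forall_sdiff_eq_zero measurableSet_Ioi Ioc_subset_Ioi_self]
  · simp only [smul_eq_mul, mul_comm]
  · intro x hx
    rw [hzero x (not_le.1 fun h => hx.2 ⟨hx.1, h⟩), zero_mul]

end FoxH

end

theorem theorem2 {p q : ℕ} (hp : 0 < p)
    (A a : Fin p → ℝ) (B b : Fin q → ℝ)
    (hA : ∀ k, 0 < A k) (hB : ∀ j, 0 < B j)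
    (hΔ : FoxH.Delta A B = 0)
    (m : ℕ) (hμ : FoxH.mu a b = -(m : ℝ))
    (c φ₁ φ₂ : ℝ) (hc : FoxH.gam A a < c) (hφ₁ : φ₁ < 0) (hφ₂ : 0 < φ₂)
    (s : ℂ) (hs : FoxH.gam A a < s.re) :
    MellinConvergent (FoxH.H A a B b c φ₁ φ₂) s ∧
    mellin (FoxH.H A a B b c φ₁ φ₂) s =
      (∫ x in (0 : ℝ)..FoxH.rho A B, FoxH.H A a B b c φ₁ φ₂ x * (x : ℂ) ^ (s - 1)) ∧
    (∫ x in (0 : ℝ)..FoxH.rho A B, FoxH.H A a B b c φ₁ φ₂ x * (x : ℂ) ^ (s - 1)) =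
      FoxH.gammaRatio A a B b s -
        (FoxH.nu A a B b : ℂ) * (FoxH.rho A B : ℂ) ^ s *
          ∑ k ∈ Finset.range (m + 1), (FoxH.lCoeff A a B b (m - k) : ℂ) * s ^ k := by
  have hρ := FoxH.rho_pos hA hB
  have hzero : ∀ x, FoxH.rho A B < x → FoxH.H A a B b c φ₁ φ₂ x = 0 := fun _ =>
    FoxH.H_eq_zero hA hB hΔ hμ hc φ₁ φ₂
  obtain ⟨hint, hval⟩ := FoxH.integral_H_mul_cpow hA hB hΔ hμ hc hφ₁ hφ₂ hs
  refine ⟨FoxH.mellinConvergent_of_forall_gt_eq_zero hzero hint,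
    FoxH.mellin_eq_intervalIntegral_of_forall_gt_eq_zero hρ.le hzero s, ?_⟩
  rw [intervalIntegral.integral_of_le hρ.le, hval, FoxH.rho_cpow_mul_remainder hA hB,
    FoxH.principalPart]
  ring
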